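/- Theorem 1. Consider the third-order difference equation $$(n+1)^6a_0(n)x_{n+1}+a_1(n)x_n-4(2n-1)a_2(n)x_{n-1}-4(n-1)^4(2n-1)(2n-3)a_0(n+1)x_{n-2}=0\qquad(n\ge 2),\tag{1}$$ where $$a_0(n)=41218n^3-48459n^2+20010n-2871,$$ $$a_1(n)=2(48802112n^9+89030880n^8+36002654n^7-24317344n^6-19538418n^5+1311365n^4+3790503n^3+460056n^2-271701n-60291),$$ $$a_2(n)=3874492n^8-2617900n^7-3144314n^6+2947148n^5+647130n^4-1182926n^3+115771n^2+170716n-44541,$$ and let $\{q_n\}$, $\{p_n\}$, $\{\tilde p_n\}$ ($n=0,1,2,\dots$) be its rational solutions, which are linearly independent, with initial data $$q_0=-1,\ q_1=42,\ q_2=-17934;\qquad p_0=0,\ p_1=\tfrac{87}{2},\ p_2=-\tfrac{1190161}{64};\qquad \tilde p_0=0,\ \tilde p_1=\tfrac{101}{2},\ \tilde p_2=-\tfrac{344923}{16}.$$ Then the sequences $\ell_n=q_n\zeta(5)-p_n$ and $\tilde\ell_n=q_n\zeta(3)-\tilde p_n$ ($n=0,1,2,\dots$) also satisfy (1), and they are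 of constant sign: $\ell_n>0$ and $\tilde\ell_n<0$ for all $n\ge 1$. The characteristic polynomial of (1), that is, the monic cubic whose lower coefficients are the limits, as $n\to\infty$, of the coefficients of $x_n$, $x_{n-1}$, $x_{n-2}$ in (1) divided by that of $x_{n+1}$, is $\mu^3+2368\mu^2-752\mu-16$; its roots are the real numbers $$\mu_1=-0.02001512\dots,\qquad \mu_2=0.33753726\dots,\qquad \mu_3=-2368.31752213\dots,$$ and $$\lim_{n\to\infty}\frac{\log|\ell_n|}{n}=\lim_{n\to\infty}\frac{\log|\tilde\ell_n|}{n}=\log|\mu_2|=-1.08607936\dots,$$ $$\lim_{n\to\infty}\frac{\log|q_n|}{n}=\lim_{n\to\infty}\frac{\log|p_n|}{n}=\lim_{n\to\infty}\frac{\log|\tilde p_n|}{n}=\log|\mu_3|.$$ Consequently $p_n/q_n\to\zeta(5)$ at a geometric rate: $\lim_{n\to\infty}\frac1n\log\left|\zeta(5)-\frac{p_n}{q_n}\right|=\log\left|\frac{\mu_2}{\mu_3}\right|$, where $|\mu_2/\mu_3|<1.42521964\cdot10^{-4}$. -/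

import Mathlib

open Filter Topology Polynomial

namespace ZetaFive

/-- The polynomial `a₀`. -/
def a₀ {R : Type*} [CommRing R] (n : R) : R :=
  41218 * n ^ 3 - 48459 * n ^ 2 + 20010 * n - 2871

/-- The polynomial `a₁`. -/
def a₁ {R : Type*} [CommRing R] (n : R) : R :=
  2 * (48802112 * n ^ 9 + 89030880 * n ^ 8 + 36002654 * n ^ 7 - 24317344 * n ^ 6
    - 19538418 * n ^ 5 + 1311365 * n ^ 4 + 3790503 * n ^ 3 + 460056 * n ^ 2
    - 271701 * n - 60291)

/-- The polynomial `a₂`. -/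
def a₂ {R : Type*} [CommRing R] (n : R) : R :=
  3874492 * n ^ 8 - 2617900 * n ^ 7 - 3144314 * n ^ 6 + 2947148 * n ^ 5 + 647130 * n ^ 4
    - 1182926 * n ^ 3 + 115771 * n ^ 2 + 170716 * n - 44541

/-- Coefficient of `x_{n+1}` in the difference equation. -/
def c₃ {R : Type*} [CommRing R] (n : R) : R := (n + 1) ^ 6 * a₀ n

/-- Coefficient of `x_n` in the difference equation. -/
def c₂ {R : Type*} [CommRing R] (n : R) : R := a₁ n

/-- Coefficient of `x_{n-1}` in the difference equation. -/
def c₁ {R : Type*} [CommRing R] (n : R) : R := -(4 * (2 * n - 1) * a₂ n)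

/-- Coefficient of `x_{n-2}` in the difference equation. -/
def c₀ {R : Type*} [CommRing R] (n : R) : R :=
  -(4 * (n - 1) ^ 4 * (2 * n - 1) * (2 * n - 3) * a₀ (n + 1))

/-- The sequence `x_0, x_1, x_2, …` satisfies the third-order difference equation
`c₃(n) x_{n+1} + c₂(n) x_n + c₁(n) x_{n-1} + c₀(n) x_{n-2} = 0` for every `n ≥ 2`. -/
def IsSolution {R : Type*} [CommRing R] (x : ℕ → R) : Prop :=
  ∀ n : ℕ, 2 ≤ n →
    c₃ (n : R) * x (n + 1) + c₂ (n : R) * x n + c₁ (n : R) * x (n - 1)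
      + c₀ (n : R) * x (n - 2) = 0

/-- The sequence generated by the difference equation from its three initial values: the
equation with parameter `n + 2`, solved for the term of index `n + 3`. -/
def solution (x₀ x₁ x₂ : ℚ) : ℕ → ℚ
  | 0 => x₀
  | 1 => x₁
  | 2 => x₂
  | n + 3 =>
    -(c₂ ((n : ℚ) + 2) * solution x₀ x₁ x₂ (n + 2)
      + c₁ ((n : ℚ) + 2) * solution x₀ x₁ x₂ (n + 1)
      + c₀ ((n : ℚ) + 2) * solution x₀ x₁ x₂ n) / c₃ ((n : ℚ) + 2)

/-- The sequence `q_n`. -/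
def q : ℕ → ℚ := solution (-1) 42 (-17934)

/-- The sequence `p_n`. -/
def p : ℕ → ℚ := solution 0 (87 / 2) (-(1190161 / 64))

/-- The sequence `p̃_n`. -/
def pTilde : ℕ → ℚ := solution 0 (101 / 2) (-(344923 / 16))

/-- The real value `ζ(s)` of the Riemann zeta function at a real point. -/
noncomputable def zetaR (s : ℝ) : ℝ := (riemannZeta (s : ℂ)).re

/-- The linear form `ℓ_n = q_n ζ(5) - p_n`. -/
noncomputable def ell (n : ℕ) : ℝ := (q n : ℝ) * zetaR 5 - (p n : ℝ)

/-- The linear form `ℓ̃_n = q_n ζ(3) - p̃_n`. -/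
noncomputable def ellTilde (n : ℕ) : ℝ := (q n : ℝ) * zetaR 3 - (pTilde n : ℝ)

/-- `P` is the characteristic polynomial of the difference equation: the monic cubic whose lower
coefficients are the limits of the coefficients of the equation divided by the leading one. -/
def IsCharacteristicPolynomial (P : ℝ[X]) : Prop :=
  P.Monic ∧ P.natDegree = 3 ∧
    Tendsto (fun n : ℕ => c₂ (n : ℝ) / c₃ (n : ℝ)) atTop (𝓝 (P.coeff 2)) ∧
    Tendsto (fun n : ℕ => c₁ (n : ℝ) / c₃ (n : ℝ)) atTop (𝓝 (P.coeff 1)) ∧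
    Tendsto (fun n : ℕ => c₀ (n : ℝ) / c₃ (n : ℝ)) atTop (𝓝 (P.coeff 0))

end ZetaFive

/-!
Put `r^k_n = ∑_{t ≥ 1} (2 t + n) (t (t + n))^k K_n(t)` for `k = 0, 1, 2`, where
`K_n(t) = n!⁴ ∏_{j=1}^{n} (t - j)(t + n + j) / ∏_{j=0}^{n} (t + j)⁶`. Partial fractions and the
antisymmetry `t ↦ -n - t` make each of these series a rational linear form
`u^k_n ζ(5) + w^k_n ζ(3) - v^k_n`. Creative telescoping, with certificates of degree five in `t`,
shows that the three series satisfy a first-order linear system in `n`, `IsContiguous`, which is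
then also satisfied by the coefficient vectors `u_n`, `w_n`, `v_n`; so these are determined by the
case `n = 1`, and partial fractions for general `n` are not needed.

The link with the third-order equation is that the minors `a b' - b a'` of the first two entries of
any two solutions of the system satisfy it (`IsContiguous.minor_recurrence`). Comparing initial
values, `4 ell = w⁰ r¹ - w¹ r⁰` and `-4 ellTilde = u⁰ r¹ - u¹ r⁰`. Coefficient vectors grow at most
like `760 ^ n` and the series decay at least like `n ^ 4 / 128 ^ n`, so both linear forms are
`O(7 ^ n)`, much less than the generic growth `2368 ^ n` of solutions.

Everything else follows from the equation. If some term of a solution is ten times larger than its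
two predecessors, this persists for ever, the solution grows at least like `10 ^ n`
(`IsSolution.ten_mul_le`), and the ratio of consecutive terms tends to `μ₃`
(`IsSolution.tendsto_ratio_dominant`); this is the case of `q`, `p` and `pTilde` from the start. The
two linear forms therefore never enter that regime, which bounds each of their terms by the two
preceding ones. Consequently they are bounded, which locates `ζ(5)` and `ζ(3)` precisely enough to
see the signs of the terms of index `1` and `2`; the equation, read backwards, propagates the sign
(`IsSolution.pos_of_growth`) and forces the ratio of consecutive terms to tend to the positive root
`μ₂` (`IsSolution.tendsto_ratio_of_growth`), a solution with ratio tending to the negative root `μ₁`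
having no constant sign.
-/

namespace ZetaFive

/-! ### Solutions of the difference equation -/

theorem solution_add_three (x₀ x₁ x₂ : ℚ) (n : ℕ) :
    solution x₀ x₁ x₂ (n + 3) =
      -(c₂ ((n : ℚ) + 2) * solution x₀ x₁ x₂ (n + 2)
        + c₁ ((n : ℚ) + 2) * solution x₀ x₁ x₂ (n + 1)
        + c₀ ((n : ℚ) + 2) * solution x₀ x₁ x₂ n) / c₃ ((n : ℚ) + 2) := rfl

theorem c₃_pos {K : Type*} [Field K] [LinearOrder K] [IsStrictOrderedRing K] (n : ℕ) :
    0 < c₃ ((n : K) + 2) := by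
  have hn : (0 : K) ≤ n := n.cast_nonneg
  have h : c₃ ((n : K) + 2) =
      (n + 3) ^ 6 * (41218 * n ^ 3 + 198849 * n ^ 2 + 320790 * n + 173057) := by
    unfold c₃ a₀; ring
  rw [h]; positivity

/-- For `n ≥ 2` the coefficient of `x_n` dominates the other three; this is all that the growth
arguments use of the coefficients apart from their limits. -/
theorem coeff_bounds {K : Type*} [Field K] [LinearOrder K] [IsStrictOrderedRing K] (n : ℕ) :
    20 * c₃ ((n : K) + 2) ≤ -c₁ ((n : K) + 2) ∧ 0 ≤ -c₀ ((n : K) + 2) ∧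
      -c₁ ((n : K) + 2) - c₀ ((n : K) + 2) + 30 * c₃ ((n : K) + 2) ≤ c₂ ((n : K) + 2) := by
  have hn : (0 : K) ≤ n := n.cast_nonneg
  refine ⟨?_, ?_, ?_⟩
  · rw [← sub_nonneg]; unfold c₁ c₃ a₂ a₀; ring_nf; positivity
  · unfold c₀ a₀; ring_nf; positivity
  · rw [← sub_nonneg]; unfold c₂ c₁ c₀ c₃ a₁ a₂ a₀; ring_nf; positivity

theorem isSolution_solution (x₀ x₁ x₂ : ℚ) : IsSolution (solution x₀ x₁ x₂) := by
  intro n hn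
  obtain ⟨k, rfl⟩ := Nat.exists_eq_add_of_le' hn
  have h := (c₃_pos (K := ℚ) k).ne'
  simp only [show k + 2 - 1 = k + 1 by omega, show k + 2 - 2 = k by omega,
    show k + 2 + 1 = k + 3 by omega, solution_add_three]
  push_cast
  field_simp
  ring

theorem c₃_cast (n : ℕ) : c₃ (n : ℝ) = ((c₃ (n : ℚ) : ℚ) : ℝ) := by
  simp only [c₃, a₀]; push_cast; ring

theorem c₂_cast (n : ℕ) : c₂ (n : ℝ) = ((c₂ (n : ℚ) : ℚ) : ℝ) := by
  simp only [c₂, a₁]; push_cast; ring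

theorem c₁_cast (n : ℕ) : c₁ (n : ℝ) = ((c₁ (n : ℚ) : ℚ) : ℝ) := by
  simp only [c₁, a₂]; push_cast; ring

theorem c₀_cast (n : ℕ) : c₀ (n : ℝ) = ((c₀ (n : ℚ) : ℚ) : ℝ) := by
  simp only [c₀, a₀]; push_cast; ring

theorem IsSolution.cast {x : ℕ → ℚ} (hx : IsSolution x) : IsSolution fun n => (x n : ℝ) := by
  intro n hn
  have h := hx n hn
  simp only [c₃_cast, c₂_cast, c₁_cast, c₀_cast]
  exact_mod_cast h

theorem IsSolution.mul_sub {x y : ℕ → ℝ} (hx : IsSolution x) (hy : IsSolution y) (z : ℝ) :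
    IsSolution fun n => x n * z - y n := by
  intro n hn
  linear_combination z * hx n hn - hy n hn

theorem IsSolution.neg {x : ℕ → ℝ} (hx : IsSolution x) : IsSolution fun n => -x n := by
  intro n hn
  linear_combination -hx n hn

theorem IsSolution.add_two {x : ℕ → ℝ} (hx : IsSolution x) (n : ℕ) :
    c₃ ((n : ℝ) + 2) * x (n + 3) + c₂ ((n : ℝ) + 2) * x (n + 2)
      + c₁ ((n : ℝ) + 2) * x (n + 1) + c₀ ((n : ℝ) + 2) * x n = 0 := by
  simpa using hx (n + 2) (by omega)

theorem isSolution_q : IsSolution q := isSolution_solution _ _ _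
theorem isSolution_p : IsSolution p := isSolution_solution _ _ _
theorem isSolution_pTilde : IsSolution pTilde := isSolution_solution _ _ _

theorem isSolution_ell : IsSolution ell := isSolution_q.cast.mul_sub isSolution_p.cast _

theorem isSolution_ellTilde : IsSolution ellTilde :=
  isSolution_q.cast.mul_sub isSolution_pTilde.cast _

@[simp] theorem q_zero : q 0 = -1 := rfl
@[simp] theorem q_one : q 1 = 42 := rfl
@[simp] theorem q_two : q 2 = -17934 := rfl
@[simp] theorem p_zero : p 0 = 0 := rfl
@[simp] theorem p_one : p 1 = 87 / 2 := rfl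
@[simp] theorem p_two : p 2 = -(1190161 / 64) := rfl
@[simp] theorem pTilde_zero : pTilde 0 = 0 := rfl
@[simp] theorem pTilde_one : pTilde 1 = 101 / 2 := rfl
@[simp] theorem pTilde_two : pTilde 2 = -(344923 / 16) := rfl

theorem linearIndependent_q_p_pTilde : LinearIndependent ℚ ![q, p, pTilde] := by
  rw [Fintype.linearIndependent_iff]
  intro g hg
  have h (n : ℕ) : g 0 * q n + g 1 * p n + g 2 * pTilde n = 0 := by
    simpa [Fin.sum_univ_three] using congrFun hg n
  have h0 := h 0
  have h1 := h 1
  have h2 := h 2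
  simp at h0 h1 h2
  have e2 : g 2 = 0 := by rw [h0] at h1 h2; linarith
  have e1 : g 1 = 0 := by rw [h0, e2] at h1; linarith
  intro i
  fin_cases i <;> assumption

theorem q_three : q 3 = 14290980 := by
  have h := (isSolution_q) 2 (by norm_num)
  norm_num [q_zero, q_one, q_two, c₃, c₂, c₁, c₀, a₂, a₁, a₀] at h
  linarith

theorem q_four : q 4 = -15226085070 := by
  have h := (isSolution_q) 3 (by norm_num)
  norm_num [q_one, q_two, q_three, c₃, c₂, c₁, c₀, a₂, a₁, a₀] at h
  linarith

theorem p_three : p 3 = 38410106195 / 2592 := by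
  have h := (isSolution_p) 2 (by norm_num)
  norm_num [p_zero, p_one, p_two, c₃, c₂, c₁, c₀, a₂, a₁, a₀] at h
  linarith

theorem p_four : p 4 = -(873032613281675 / 55296) := by
  have h := (isSolution_p) 3 (by norm_num)
  norm_num [p_one, p_two, p_three, c₃, c₂, c₁, c₀, a₂, a₁, a₀] at h
  linarith

theorem pTilde_three : pTilde 3 = 3710571371 / 216 := by
  have h := (isSolution_pTilde) 2 (by norm_num)
  norm_num [pTilde_zero, pTilde_one, pTilde_two, c₃, c₂, c₁, c₀, a₂, a₁, a₀] at h
  linarith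

theorem pTilde_four : pTilde 4 = -(21084619007795 / 1152) := by
  have h := (isSolution_pTilde) 3 (by norm_num)
  norm_num [pTilde_one, pTilde_two, pTilde_three, c₃, c₂, c₁, c₀, a₂, a₁, a₀] at h
  linarith

/-! ### Two limit lemmas -/

/-- A bounded nonnegative sequence each of whose terms is, up to a null sequence, at most a small
multiple of its two predecessors and its successor tends to zero. -/
theorem tendsto_zero_of_contraction {e d : ℕ → ℝ} {θ M : ℝ} (hθ : 0 ≤ θ) (hθ' : 3 * θ < 1)
    (he : ∀ n, 0 ≤ e n) (hM : ∀ᶠ n in atTop, e n ≤ M) (hd : Tendsto d atTop (𝓝 0))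
    (h : ∀ᶠ n in atTop, e (n + 2) ≤ θ * (e n + e (n + 1) + e (n + 3)) + d n) :
    Tendsto e atTop (𝓝 0) := by
  set r := (1 + 3 * θ) / 2 with hr
  have hr0 : 0 < r := by positivity
  have hr1 : r < 1 := by linarith
  have key (k : ℕ) : ∀ᶠ n in atTop, e n ≤ max M 1 * r ^ k := by
    induction k with
    | zero => filter_upwards [hM] with n hn using by simpa using Or.inl hn
    | succ k ih =>
      set b := max M 1 * r ^ k with hb
      have hb0 : 0 < b := by positivity
      have hd' : ∀ᶠ n in atTop, d n < (r - 3 * θ) * b :=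
        hd.eventually_lt_const (by have : 0 < r - 3 * θ := by linarith
                                   positivity)
      obtain ⟨N, hN⟩ := eventually_atTop.1 (ih.and (hd'.and h))
      refine eventually_atTop.2 ⟨N + 2, fun n hn => ?_⟩
      obtain ⟨j, rfl⟩ := Nat.exists_eq_add_of_le' (show 2 ≤ n by omega)
      have h0 := hN j (by omega)
      have h1 := (hN (j + 1) (by omega)).1
      have h3 := (hN (j + 3) (by omega)).1
      have : θ * (e j + e (j + 1) + e (j + 3)) ≤ θ * (b + b + b) := by
        gcongr; exact h0.1
      calc e (j + 2) ≤ θ * (b + b + b) + (r - 3 * θ) * b := by linarith [h0.2.1, h0.2.2]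
        _ = max M 1 * r ^ (k + 1) := by rw [hb]; ring
  rw [Metric.tendsto_atTop]
  intro ε hε
  have ht : Tendsto (fun k => max M 1 * r ^ k) atTop (𝓝 (max M 1 * 0)) :=
    (tendsto_pow_atTop_nhds_zero_of_lt_one hr0.le hr1).const_mul _
  rw [mul_zero] at ht
  obtain ⟨k, hk⟩ := (ht.eventually_lt_const hε).exists
  obtain ⟨N, hN⟩ := eventually_atTop.1 (key k)
  refine ⟨N, fun n hn => ?_⟩
  rw [Real.dist_eq, sub_zero, abs_of_nonneg (he n)]
  exact (hN n hn).trans_lt hk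

theorem tendsto_log_div_of_tendsto_ratio {x : ℕ → ℝ} {μ : ℝ} (hμ : μ ≠ 0)
    (h : Tendsto (fun n => x (n + 1) / x n) atTop (𝓝 μ)) (hx : ∀ᶠ n in atTop, x n ≠ 0) :
    Tendsto (fun n : ℕ => Real.log |x n| / n) atTop (𝓝 (Real.log |μ|)) := by
  have h1 : Tendsto (fun n => Real.log |x (n + 1) / x n|) atTop (𝓝 (Real.log |μ|)) :=
    (h.abs).log (by simpa using hμ)
  have h2 : Tendsto (fun n => Real.log |x (n + 1)| - Real.log |x n|) atTop
      (𝓝 (Real.log |μ|)) := by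
    refine h1.congr' ?_
    filter_upwards [hx, (tendsto_add_atTop_nat 1).eventually hx] with n hn hn1
    rw [abs_div, Real.log_div (by simpa using hn1) (by simpa using hn)]
  have h3 := h2.cesaro
  simp only [Finset.sum_range_sub (fun n => Real.log |x n|)] at h3
  have h4 : Tendsto (fun n : ℕ => Real.log |x 0| / (n : ℝ)) atTop (𝓝 0) :=
    tendsto_const_div_atTop_nhds_zero_nat _
  have h5 := h3.add h4
  rw [add_zero] at h5
  refine h5.congr fun n => ?_
  ring

/-! ### Growth of the solutions -/

/-- Solved for its leading term, the equation with parameter `n + 2` reads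
`x_{n+3} = -A_n x_{n+2} + B_n x_{n+1} + C_n x_n`; this is `A_n`. With these signs all three
coefficients are nonnegative. -/
noncomputable def coeffA (n : ℕ) : ℝ := c₂ ((n : ℝ) + 2) / c₃ ((n : ℝ) + 2)

/-- The coefficient `B_n`, see `coeffA`. -/
noncomputable def coeffB (n : ℕ) : ℝ := -c₁ ((n : ℝ) + 2) / c₃ ((n : ℝ) + 2)

/-- The coefficient `C_n`, see `coeffA`. -/
noncomputable def coeffC (n : ℕ) : ℝ := -c₀ ((n : ℝ) + 2) / c₃ ((n : ℝ) + 2)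

theorem coeffB_ge (n : ℕ) : 20 ≤ coeffB n := by
  rw [coeffB, le_div_iff₀ (c₃_pos n)]
  exact (coeff_bounds n).1

theorem coeffC_nonneg (n : ℕ) : 0 ≤ coeffC n :=
  div_nonneg (coeff_bounds n).2.1 (c₃_pos n).le

theorem coeff_sum_le (n : ℕ) : coeffB n + coeffC n + 30 ≤ coeffA n := by
  have h := (coeff_bounds (K := ℝ) n).2.2
  have h3 := c₃_pos (K := ℝ) n
  rw [coeffA, le_div_iff₀ h3, coeffB, coeffC]
  calc _ = -c₁ ((n : ℝ) + 2) - c₀ ((n : ℝ) + 2) + 30 * c₃ ((n : ℝ) + 2) := by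
        field_simp; ring
    _ ≤ _ := h

theorem IsSolution.eq {x : ℕ → ℝ} (hx : IsSolution x) (n : ℕ) :
    x (n + 3) = -coeffA n * x (n + 2) + coeffB n * x (n + 1) + coeffC n * x n := by
  have h := hx.add_two n
  have h3 := (c₃_pos (K := ℝ) n).ne'
  rw [coeffA, coeffB, coeffC]
  field_simp
  linear_combination h

theorem IsSolution.coeffA_mul_abs_le {x : ℕ → ℝ} (hx : IsSolution x) (n : ℕ) :
    coeffA n * |x (n + 2)| ≤ coeffB n * |x (n + 1)| + coeffC n * |x n| + |x (n + 3)| := by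
  have hB := coeffB_ge n
  have hC := coeffC_nonneg n
  have hA := coeff_sum_le n
  have e : coeffA n * x (n + 2) = coeffB n * x (n + 1) + coeffC n * x n - x (n + 3) := by
    rw [hx.eq n]; ring
  calc coeffA n * |x (n + 2)| = |coeffA n * x (n + 2)| := by
        rw [abs_mul, abs_of_nonneg (a := coeffA n) (by linarith)]
    _ ≤ |coeffB n * x (n + 1)| + |coeffC n * x n| + |x (n + 3)| := by
        rw [e]; exact (abs_sub _ _).trans (by gcongr; exact abs_add_le _ _)
    _ = _ := by
        rw [abs_mul, abs_mul, abs_of_nonneg (a := coeffB n) (by linarith), abs_of_nonneg hC]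

/-- Once a term of a solution is ten times larger than its two predecessors, so is the next one. -/
theorem IsSolution.ten_mul_le {x : ℕ → ℝ} (hx : IsSolution x) {n : ℕ}
    (h1 : 10 * |x (n + 1)| ≤ |x (n + 2)|) (h0 : 10 * |x n| ≤ |x (n + 2)|) :
    10 * |x (n + 2)| ≤ |x (n + 3)| := by
  have hB := coeffB_ge n
  have hC := coeffC_nonneg n
  have hA := coeff_sum_le n
  have e' := hx.coeffA_mul_abs_le n
  have hb : coeffB n * |x (n + 1)| ≤ coeffB n * |x (n + 2)| := 
    mul_le_mul_of_nonneg_left (by linarith [abs_nonneg (x (n + 1))]) (by linarith)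
  have hc : coeffC n * |x n| ≤ coeffC n * |x (n + 2)| := 
    mul_le_mul_of_nonneg_left (by linarith [abs_nonneg (x n)]) hC
  have ha : (coeffB n + coeffC n + 30) * |x (n + 2)| ≤ coeffA n * |x (n + 2)| := by gcongr
  nlinarith [abs_nonneg (x (n + 2))]

theorem IsSolution.ten_mul_le_add {x : ℕ → ℝ} (hx : IsSolution x) {n : ℕ}
    (h1 : 10 * |x (n + 1)| ≤ |x (n + 2)|) (h0 : 10 * |x n| ≤ |x (n + 2)|) (k : ℕ) :
    10 * |x (n + k + 1)| ≤ |x (n + k + 2)| ∧ 10 * |x (n + k)| ≤ |x (n + k + 2)| := by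
  induction k with
  | zero => exact ⟨h1, h0⟩
  | succ k ih =>
    have h := hx.ten_mul_le ih.1 ih.2
    refine ⟨h, le_trans ?_ h⟩
    have := ih.1
    change 10 * |x (n + k + 1)| ≤ 10 * |x (n + k + 2)|
    linarith [abs_nonneg (x (n + k + 1))]

theorem IsSolution.ten_pow_le {x : ℕ → ℝ} (hx : IsSolution x) {n : ℕ}
    (h1 : 10 * |x (n + 1)| ≤ |x (n + 2)|) (h0 : 10 * |x n| ≤ |x (n + 2)|) (k : ℕ) :
    10 ^ k * |x (n + 2)| ≤ |x (n + k + 2)| := by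
  induction k with
  | zero => simp
  | succ k ih =>
    have h := (hx.ten_mul_le_add h1 h0 (k + 1)).1
    calc 10 ^ (k + 1) * |x (n + 2)| = 10 * (10 ^ k * |x (n + 2)|) := by ring
      _ ≤ 10 * |x (n + k + 2)| := by gcongr
      _ ≤ _ := h

/-- A solution of growth `O(7 ^ n)` avoids the cone of `IsSolution.ten_mul_le`. -/
theorem IsSolution.abs_le_of_growth {x : ℕ → ℝ} (hx : IsSolution x) {D : ℝ}
    (hD : ∀ n, |x (n + 1)| ≤ D * 7 ^ n) (n : ℕ) :
    |x (n + 2)| ≤ 10 * max |x (n + 1)| |x n| := by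
  by_contra! hcon
  have h1 : 10 * |x (n + 1)| ≤ |x (n + 2)| :=
    (mul_le_mul_of_nonneg_left (le_max_left _ _) (by norm_num)).trans hcon.le
  have h0 : 10 * |x n| ≤ |x (n + 2)| :=
    (mul_le_mul_of_nonneg_left (le_max_right _ _) (by norm_num)).trans hcon.le
  have hpos : 0 < |x (n + 2)| := lt_of_le_of_lt (by positivity) hcon
  have hD0 : 0 ≤ D := by simpa using (abs_nonneg _).trans (hD 0)
  have key (k : ℕ) : (10 / 7 : ℝ) ^ k ≤ D * 7 ^ (n + 1) / |x (n + 2)| := by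
    rw [le_div_iff₀ hpos, div_pow, div_mul_eq_mul_div, div_le_iff₀ (by positivity)]
    calc 10 ^ k * |x (n + 2)| ≤ |x (n + k + 2)| := hx.ten_pow_le h1 h0 k
      _ ≤ D * 7 ^ (n + k + 1) := hD _
      _ = D * 7 ^ (n + 1) * 7 ^ k := by ring
  have ht := tendsto_pow_atTop_atTop_of_one_lt (show (1 : ℝ) < 10 / 7 by norm_num)
  obtain ⟨k, hk⟩ := (ht.eventually_gt_atTop (D * 7 ^ (n + 1) / |x (n + 2)|)).exists
  exact absurd (key k) (not_le.2 hk)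

theorem IsSolution.abs_le_max {x : ℕ → ℝ} (hx : IsSolution x)
    (h : ∀ n, |x (n + 2)| ≤ 10 * max |x (n + 1)| |x n|) (n : ℕ) :
    |x (n + 2)| ≤ max |x (n + 1)| |x n| := by
  set m := max |x (n + 1)| |x n| with hm
  by_contra! hcon
  have hB := coeffB_ge n
  have hC := coeffC_nonneg n
  have hA := coeff_sum_le n
  have h1 : |x (n + 1)| ≤ m := le_max_left _ _
  have h0 : |x n| ≤ m := le_max_right _ _
  have h3 : |x (n + 3)| ≤ 10 * |x (n + 2)| := by
    have := h (n + 1)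
    rwa [max_eq_left (show |x (n + 1)| ≤ |x (n + 1 + 1)| from h1.trans hcon.le)] at this
  have e' := hx.coeffA_mul_abs_le n
  have hb : coeffB n * |x (n + 1)| ≤ coeffB n * |x (n + 2)| :=
    mul_le_mul_of_nonneg_left (by linarith) (by linarith)
  have hc : coeffC n * |x n| ≤ coeffC n * |x (n + 2)| :=
    mul_le_mul_of_nonneg_left (by linarith) hC
  have ha : (coeffB n + coeffC n + 30) * |x (n + 2)| ≤ coeffA n * |x (n + 2)| := by gcongr
  have hpos : 0 < |x (n + 2)| := lt_of_le_of_lt ((abs_nonneg _).trans h0) hcon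
  nlinarith

theorem IsSolution.abs_le_max_initial {x : ℕ → ℝ} (hx : IsSolution x)
    (h : ∀ n, |x (n + 2)| ≤ 10 * max |x (n + 1)| |x n|) (n : ℕ) :
    |x n| ≤ max |x 1| |x 0| := by
  have key : |x n| ≤ max |x 1| |x 0| ∧ |x (n + 1)| ≤ max |x 1| |x 0| := by
    induction n with
    | zero => exact ⟨le_max_right _ _, le_max_left _ _⟩
    | succ n ih => exact ⟨ih.2, (hx.abs_le_max h n).trans (max_le ih.2 ih.1)⟩
  exact key.1

/-- Positivity of a slowly growing solution propagates from its terms of index `1` and `2`. -/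
theorem IsSolution.pos_of_growth {x : ℕ → ℝ} (hx : IsSolution x)
    (h : ∀ n, |x (n + 2)| ≤ 10 * max |x (n + 1)| |x n|) (h1 : 0 < x 1) (h2 : 0 < x 2) (n : ℕ) :
    0 < x (n + 1) := by
  have key : 0 < x (n + 1) ∧ 0 < x (n + 2) := by
    induction n with
    | zero => exact ⟨h1, h2⟩
    | succ n ih =>
      refine ⟨ih.2, ?_⟩
      have hB := coeffB_ge (n + 1)
      have hC := coeffC_nonneg (n + 1)
      have hA := coeff_sum_le (n + 1)
      have e : coeffA (n + 1) * x (n + 3) =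
          coeffB (n + 1) * x (n + 2) + coeffC (n + 1) * x (n + 1) - x (n + 4) := by
        rw [hx.eq (n + 1)]; ring
      have h4 : |x (n + 4)| ≤ 10 * max |x (n + 3)| |x (n + 2)| := h (n + 2)
      have hc : 0 ≤ coeffC (n + 1) * x (n + 1) := mul_nonneg hC ih.1.le
      have hb : 20 * x (n + 2) ≤ coeffB (n + 1) * x (n + 2) :=
        mul_le_mul_of_nonneg_right hB ih.2.le
      change 0 < x (n + 3)
      rw [abs_of_pos ih.2] at h4
      have h4' := (le_abs_self _).trans h4
      rcases le_total |x (n + 3)| (x (n + 2)) with hle | hle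
      · rw [max_eq_right hle] at h4'
        have : 0 < coeffA (n + 1) * x (n + 3) := by linarith [ih.2]
        exact pos_of_mul_pos_right this (by linarith)
      · rw [max_eq_left hle] at h4'
        by_contra! hneg
        rw [abs_of_nonpos hneg] at h4'
        nlinarith [ih.2]
  exact key.1

/-! ### The characteristic polynomial -/

/-- A quotient of polynomial functions, written as polynomials of degree at most `d` in `n⁻¹`. -/
theorem tendsto_div_of_inv {f g : ℕ → ℝ} {F G : ℝ → ℝ} (d : ℕ) (hF : Continuous F)
    (hG : Continuous G) (hG0 : G 0 ≠ 0) (hf : ∀ n : ℕ, n ≠ 0 → f n = (n : ℝ) ^ d * F (n : ℝ)⁻¹)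
    (hg : ∀ n : ℕ, n ≠ 0 → g n = (n : ℝ) ^ d * G (n : ℝ)⁻¹) :
    Tendsto (fun n => f n / g n) atTop (𝓝 (F 0 / G 0)) := by
  have hinv : Tendsto (fun n : ℕ => (n : ℝ)⁻¹) atTop (𝓝 0) := tendsto_inv_atTop_nhds_zero_nat
  have h := ((hF.tendsto 0).comp hinv).div ((hG.tendsto 0).comp hinv) hG0
  refine h.congr' ?_
  filter_upwards [eventually_ne_atTop 0] with n hn
  rw [hf n hn, hg n hn, mul_div_mul_left _ _ (pow_ne_zero _ (Nat.cast_ne_zero.2 hn))]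
  rfl

theorem c₃_eq_pow_mul (n : ℕ) (hn : n ≠ 0) : c₃ (n : ℝ) = (n : ℝ) ^ 9 *
    ((1 + (n : ℝ)⁻¹) ^ 6 * (41218 - 48459 * (n : ℝ)⁻¹ + 20010 * (n : ℝ)⁻¹ ^ 2
      - 2871 * (n : ℝ)⁻¹ ^ 3)) := by
  have hn' : (n : ℝ) ≠ 0 := Nat.cast_ne_zero.2 hn
  unfold c₃ a₀
  field_simp

theorem tendsto_c₂_div_c₃ :
    Tendsto (fun n : ℕ => c₂ (n : ℝ) / c₃ (n : ℝ)) atTop (𝓝 2368) := by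
  have h := tendsto_div_of_inv (f := fun n => c₂ (n : ℝ)) (g := fun n => c₃ (n : ℝ)) 9
    (F := fun y => 2 * (48802112 + 89030880 * y + 36002654 * y ^ 2 - 24317344 * y ^ 3
      - 19538418 * y ^ 4 + 1311365 * y ^ 5 + 3790503 * y ^ 6 + 460056 * y ^ 7
      - 271701 * y ^ 8 - 60291 * y ^ 9))
    (G := fun y => (1 + y) ^ 6 * (41218 - 48459 * y + 20010 * y ^ 2 - 2871 * y ^ 3))
    (by fun_prop) (by fun_prop) (by norm_num) ?_ c₃_eq_pow_mul
  · norm_num at h; exact h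
  · intro n hn
    have hn' : (n : ℝ) ≠ 0 := Nat.cast_ne_zero.2 hn
    unfold c₂ a₁
    field_simp

theorem tendsto_c₁_div_c₃ :
    Tendsto (fun n : ℕ => c₁ (n : ℝ) / c₃ (n : ℝ)) atTop (𝓝 (-752)) := by
  have h := tendsto_div_of_inv (f := fun n => c₁ (n : ℝ)) (g := fun n => c₃ (n : ℝ)) 9
    (F := fun y => -(4 * (2 - y) * (3874492 - 2617900 * y - 3144314 * y ^ 2
      + 2947148 * y ^ 3 + 647130 * y ^ 4 - 1182926 * y ^ 5 + 115771 * y ^ 6 + 170716 * y ^ 7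
      - 44541 * y ^ 8)))
    (G := fun y => (1 + y) ^ 6 * (41218 - 48459 * y + 20010 * y ^ 2 - 2871 * y ^ 3))
    (by fun_prop) (by fun_prop) (by norm_num) ?_ c₃_eq_pow_mul
  · norm_num at h; exact h
  · intro n hn
    have hn' : (n : ℝ) ≠ 0 := Nat.cast_ne_zero.2 hn
    unfold c₁ a₂
    field_simp

theorem tendsto_c₀_div_c₃ :
    Tendsto (fun n : ℕ => c₀ (n : ℝ) / c₃ (n : ℝ)) atTop (𝓝 (-16)) := by
  have h := tendsto_div_of_inv (f := fun n => c₀ (n : ℝ)) (g := fun n => c₃ (n : ℝ)) 9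
    (F := fun y => -(4 * (1 - y) ^ 4 * (2 - y) * (2 - 3 * y) * (41218 * (1 + y) ^ 3
      - 48459 * (1 + y) ^ 2 * y + 20010 * (1 + y) * y ^ 2 - 2871 * y ^ 3)))
    (G := fun y => (1 + y) ^ 6 * (41218 - 48459 * y + 20010 * y ^ 2 - 2871 * y ^ 3))
    (by fun_prop) (by fun_prop) (by norm_num) ?_ c₃_eq_pow_mul
  · norm_num at h; exact h
  · intro n hn
    have hn' : (n : ℝ) ≠ 0 := Nat.cast_ne_zero.2 hn
    unfold c₀ a₀
    field_simp

theorem isCharacteristicPolynomial :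
    IsCharacteristicPolynomial (X ^ 3 + C 2368 * X ^ 2 - C 752 * X - C 16 : ℝ[X]) := by
  refine ⟨by monicity!, by compute_degree!, ?_, ?_, ?_⟩
  · have e : (X ^ 3 + C 2368 * X ^ 2 - C 752 * X - C 16 : ℝ[X]).coeff 2 = 2368 := by
      simp
    rw [e]; exact tendsto_c₂_div_c₃
  · have e : (X ^ 3 + C 2368 * X ^ 2 - C 752 * X - C 16 : ℝ[X]).coeff 1 = -752 := by
      simp [coeff_C, coeff_X_pow]
    rw [e]; exact tendsto_c₁_div_c₃
  · have e : (X ^ 3 + C 2368 * X ^ 2 - C 752 * X - C 16 : ℝ[X]).coeff 0 = -16 := by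
      simp
    rw [e]; exact tendsto_c₀_div_c₃

theorem exists_root_of_sign {l u : ℝ} (h : l < u)
    (hs : (l ^ 3 + 2368 * l ^ 2 - 752 * l - 16) * (u ^ 3 + 2368 * u ^ 2 - 752 * u - 16) < 0) :
    ∃ μ, l < μ ∧ μ < u ∧ μ ^ 3 + 2368 * μ ^ 2 - 752 * μ - 16 = 0 := by
  have hc : ContinuousOn (fun μ : ℝ => μ ^ 3 + 2368 * μ ^ 2 - 752 * μ - 16) (Set.Icc l u) := by
    fun_prop
  rcases mul_neg_iff.1 hs with ⟨hl, hu⟩ | ⟨hl, hu⟩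
  · obtain ⟨μ, hμ, h0⟩ := intermediate_value_Ioo' h.le hc ⟨hu, hl⟩
    exact ⟨μ, hμ.1, hμ.2, h0⟩
  · obtain ⟨μ, hμ, h0⟩ := intermediate_value_Ioo h.le hc ⟨hl, hu⟩
    exact ⟨μ, hμ.1, hμ.2, h0⟩

theorem roots_eq_of_distinct {μ₁ μ₂ μ₃ : ℝ} (h₁₂ : μ₁ ≠ μ₂) (h₁₃ : μ₁ ≠ μ₃) (h₂₃ : μ₂ ≠ μ₃)
    (h₁ : μ₁ ^ 3 + 2368 * μ₁ ^ 2 - 752 * μ₁ - 16 = 0)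
    (h₂ : μ₂ ^ 3 + 2368 * μ₂ ^ 2 - 752 * μ₂ - 16 = 0)
    (h₃ : μ₃ ^ 3 + 2368 * μ₃ ^ 2 - 752 * μ₃ - 16 = 0) :
    (X ^ 3 + C 2368 * X ^ 2 - C 752 * X - C 16 : ℝ[X]).roots = {μ₁, μ₂, μ₃} := by
  set P := (X ^ 3 + C 2368 * X ^ 2 - C 752 * X - C 16 : ℝ[X]) with hP
  have hmon : P.Monic := isCharacteristicPolynomial.1
  have hdeg : P.natDegree = 3 := isCharacteristicPolynomial.2.1
  have hnd : ({μ₁, μ₂, μ₃} : Multiset ℝ).Nodup := by simp [h₁₂, h₁₃, h₂₃]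
  have hroot (μ : ℝ) (h : μ ^ 3 + 2368 * μ ^ 2 - 752 * μ - 16 = 0) : μ ∈ P.roots := by
    rw [mem_roots hmon.ne_zero, IsRoot, hP]
    simpa using h
  symm
  refine Multiset.eq_of_le_of_card_le ((Multiset.le_iff_subset hnd).2 ?_) ?_
  · intro μ hμ
    simp only [Multiset.insert_eq_cons, Multiset.mem_cons, Multiset.mem_singleton] at hμ
    rcases hμ with rfl | rfl | rfl
    exacts [hroot _ h₁, hroot _ h₂, hroot _ h₃]
  · exact (card_roots' P).trans (by rw [hdeg]; simp)

theorem log_bounds {μ : ℝ} (h0 : 0.3375372644 < μ) (h1 : μ < 0.3375372645) :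
    -1.08607937 < Real.log μ ∧ Real.log μ < -1.08607936 := by
  have hμ : 0 < μ := by linarith
  have hexp (y : ℝ) : Real.exp (-y) = (Real.exp (y / 2) ^ 2)⁻¹ := by
    rw [← Real.exp_nat_mul, ← Real.exp_neg]; congr 1; push_cast; ring
  constructor
  · have e : (1.721230912 : ℝ) ≤ Real.exp (1.08607937 / 2) := by
      refine le_trans ?_ (Real.sum_le_exp_of_nonneg (by norm_num) 12)
      norm_num [Finset.sum_range_succ, Nat.factorial]
    rw [Real.lt_log_iff_exp_lt hμ, hexp]
    calc (Real.exp (1.08607937 / 2) ^ 2)⁻¹ ≤ ((1.721230912 : ℝ) ^ 2)⁻¹ := by gcongr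
      _ < 0.3375372644 := by norm_num
      _ < μ := h0
  · have e : Real.exp (1.08607936 / 2) ≤ (1.72123091 : ℝ) := by
      refine (Real.exp_bound' (by norm_num) (by norm_num) (n := 12) (by norm_num)).trans ?_
      norm_num [Finset.sum_range_succ, Nat.factorial]
    rw [Real.log_lt_iff_lt_exp hμ, hexp]
    calc μ < 0.3375372645 := h1
      _ < ((1.72123091 : ℝ) ^ 2)⁻¹ := by norm_num
      _ ≤ (Real.exp (1.08607936 / 2) ^ 2)⁻¹ := by gcongr

/-! ### Limits of the ratios of consecutive terms -/

theorem tendsto_coeffA : Tendsto coeffA atTop (𝓝 2368) := by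
  refine ((tendsto_add_atTop_iff_nat 2).2 tendsto_c₂_div_c₃).congr fun n => ?_
  rw [coeffA]; push_cast; rfl

theorem tendsto_coeffB : Tendsto coeffB atTop (𝓝 752) := by
  have h := ((tendsto_add_atTop_iff_nat 2).2 tendsto_c₁_div_c₃).neg
  rw [neg_neg] at h
  refine h.congr fun n => ?_
  rw [coeffB]; push_cast; ring

theorem tendsto_coeffC : Tendsto coeffC atTop (𝓝 16) := by
  have h := ((tendsto_add_atTop_iff_nat 2).2 tendsto_c₀_div_c₃).neg
  rw [neg_neg] at h
  refine h.congr fun n => ?_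
  rw [coeffC]; push_cast; ring

theorem IsSolution.ne_zero_of_cone {x : ℕ → ℝ} (hx : IsSolution x) (hx2 : x 2 ≠ 0)
    (h1 : 10 * |x 1| ≤ |x 2|) (h0 : 10 * |x 0| ≤ |x 2|) (n : ℕ) : x (n + 2) ≠ 0 := by
  have h := hx.ten_pow_le (n := 0) h1 h0 n
  rw [zero_add, zero_add] at h
  have : 0 < |x (n + 2)| := lt_of_lt_of_le (by positivity) h
  exact abs_pos.1 this

theorem abs_inv_sub_inv_le {r μ c : ℝ} (hc : 0 < c) (hr : c ≤ |r|) (hμ : c ≤ |μ|) :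
    |r⁻¹ - μ⁻¹| ≤ |r - μ| / c ^ 2 := by
  have hr0 : r ≠ 0 := abs_pos.1 (hc.trans_le hr)
  have hμ0 : μ ≠ 0 := abs_pos.1 (hc.trans_le hμ)
  rw [inv_sub_inv hr0 hμ0, abs_div, abs_mul, abs_sub_comm, sq]
  gcongr

theorem abs_inv_le {r c : ℝ} (hc : 0 < c) (hr : c ≤ |r|) : |r⁻¹| ≤ c⁻¹ := by
  rw [abs_inv]; gcongr

theorem dominant_step {A B C μ r₀ r₁ r₂ : ℝ} (h₀ : 1000 ≤ |r₀|) (h₁ : 1000 ≤ |r₁|)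
    (hμ : 1000 ≤ |μ|) (hroot : μ = -2368 + 752 * μ⁻¹ + 16 * (μ⁻¹ * μ⁻¹))
    (h : r₂ = -A + B * r₁⁻¹ + C * (r₁⁻¹ * r₀⁻¹)) :
    |r₂ - μ| ≤ 1 / 1000 * (|r₀ - μ| + |r₁ - μ|)
      + (|A - 2368| + |B - 752| + |C - 16|) := by
  have d₀ := abs_inv_sub_inv_le (by norm_num) h₀ hμ
  have d₁ := abs_inv_sub_inv_le (by norm_num) h₁ hμ
  have b₀ := abs_inv_le (by norm_num) h₀
  have b₁ := abs_inv_le (by norm_num) h₁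
  have bμ := abs_inv_le (by norm_num) hμ
  have e : r₂ - μ = -(A - 2368) + (B - 752) * r₁⁻¹ + (C - 16) * (r₁⁻¹ * r₀⁻¹)
      + 752 * (r₁⁻¹ - μ⁻¹) + 16 * (r₁⁻¹ * (r₀⁻¹ - μ⁻¹) + μ⁻¹ * (r₁⁻¹ - μ⁻¹)) := by
    rw [h]; nth_rewrite 1 [hroot]; ring
  have t₁ : |(B - 752) * r₁⁻¹| ≤ |B - 752| := by
    rw [abs_mul]; exact mul_le_of_le_one_right (abs_nonneg _) (b₁.trans (by norm_num))
  have t₂ : |(C - 16) * (r₁⁻¹ * r₀⁻¹)| ≤ |C - 16| := by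
    rw [abs_mul, abs_mul]
    exact mul_le_of_le_one_right (abs_nonneg _)
      (mul_le_one₀ (b₁.trans (by norm_num)) (abs_nonneg _) (b₀.trans (by norm_num)))
  have t₃ : |752 * (r₁⁻¹ - μ⁻¹)| ≤ 752 * (|r₁ - μ| / 1000 ^ 2) := by
    rw [abs_mul, abs_of_pos (by norm_num : (0 : ℝ) < 752)]; gcongr
  have t₄ : |16 * (r₁⁻¹ * (r₀⁻¹ - μ⁻¹) + μ⁻¹ * (r₁⁻¹ - μ⁻¹))| ≤
      16 * (1000⁻¹ * (|r₀ - μ| / 1000 ^ 2) + 1000⁻¹ * (|r₁ - μ| / 1000 ^ 2)) := by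
    rw [abs_mul, abs_of_pos (by norm_num : (0 : ℝ) < 16)]
    gcongr
    refine (abs_add_le _ _).trans ?_
    rw [abs_mul, abs_mul]
    gcongr
  rw [e]
  refine (abs_add_le _ _).trans ?_
  refine (add_le_add_left ((abs_add_le _ _).trans (add_le_add_left ((abs_add_le _ _).trans
    (add_le_add_left (abs_add_le _ _) _)) _)) _).trans ?_
  rw [abs_neg]
  have := abs_nonneg (r₀ - μ)
  have := abs_nonneg (r₁ - μ)
  linarith

/-- Inside the cone of `IsSolution.ten_mul_le` the ratio of consecutive terms tends to the root of
largest modulus: the map `(ρ, ρ') ↦ -A + B / ρ + C / (ρ ρ')` contracts strongly where `|ρ|` and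
`|ρ'|` are large. -/
theorem IsSolution.tendsto_ratio_dominant {x : ℕ → ℝ} (hx : IsSolution x) (hx2 : x 2 ≠ 0)
    (h1 : 10 * |x 1| ≤ |x 2|) (h0 : 10 * |x 0| ≤ |x 2|) {μ : ℝ} (hμ : μ < -1000)
    (hroot : μ ^ 3 + 2368 * μ ^ 2 - 752 * μ - 16 = 0) :
    Tendsto (fun n => x (n + 1) / x n) atTop (𝓝 μ) := by
  have hne := hx.ne_zero_of_cone hx2 h1 h0
  set ρ : ℕ → ℝ := fun n => x (n + 3) / x (n + 2) with hρ
  have hρ10 (n : ℕ) : 10 ≤ |ρ n| := by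
    have h := (hx.ten_mul_le_add (n := 0) h1 h0 (n + 1)).1
    rw [hρ, abs_div, le_div_iff₀ (abs_pos.2 (hne n))]
    simpa [add_assoc] using h
  have hrec (n : ℕ) : ρ (n + 2) =
      -coeffA (n + 2) + coeffB (n + 2) * (ρ (n + 1))⁻¹
        + coeffC (n + 2) * ((ρ (n + 1))⁻¹ * (ρ n)⁻¹) := by
    have h := hx.eq (n + 2)
    have n2 := hne n
    have n3 := hne (n + 1)
    have n4 := hne (n + 2)
    simp only [hρ, add_assoc, Nat.reduceAdd] at *
    field_simp
    linear_combination h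
  have hA := ((tendsto_add_atTop_iff_nat 2).2 tendsto_coeffA)
  have hB := ((tendsto_add_atTop_iff_nat 2).2 tendsto_coeffB)
  have hC := ((tendsto_add_atTop_iff_nat 2).2 tendsto_coeffC)
  have hlarge : ∀ᶠ n in atTop, 1000 ≤ |ρ (n + 2)| ∧ |ρ (n + 2)| ≤ 3000 := by
    filter_upwards [hA.eventually_const_lt (show (2367 : ℝ) < 2368 by norm_num),
      hA.eventually_lt_const (show (2368 : ℝ) < 2369 by norm_num),
      hB.eventually_lt_const (show (752 : ℝ) < 753 by norm_num),
      hC.eventually_lt_const (show (16 : ℝ) < 17 by norm_num)] with n ha ha' hb hc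
    have b₀ := abs_inv_le (by norm_num) (hρ10 n)
    have b₁ := abs_inv_le (by norm_num) (hρ10 (n + 1))
    have hB0 := coeffB_ge (n + 2)
    have hC0 := coeffC_nonneg (n + 2)
    have tB : |coeffB (n + 2) * (ρ (n + 1))⁻¹| ≤ 753 * 10⁻¹ := by
      rw [abs_mul, abs_of_nonneg (a := coeffB (n + 2)) (by linarith)]; gcongr
    have tC : |coeffC (n + 2) * ((ρ (n + 1))⁻¹ * (ρ n)⁻¹)| ≤ 17 * (10⁻¹ * 10⁻¹) := by
      rw [abs_mul, abs_mul, abs_of_nonneg hC0]; gcongr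
    rw [abs_le] at tB tC
    rw [hrec, abs_of_neg (by linarith [tB.2, tC.2])]
    constructor <;> linarith [tB.1, tB.2, tC.1, tC.2]
  have hμ0 : μ ≠ 0 := by linarith
  have hμabs : 1000 ≤ |μ| := by rw [abs_of_neg (by linarith)]; linarith
  have hroot' : μ = -2368 + 752 * μ⁻¹ + 16 * (μ⁻¹ * μ⁻¹) := by
    field_simp; linear_combination hroot
  have hlim : Tendsto (fun n => |ρ n - μ|) atTop (𝓝 0) := by
    refine tendsto_zero_of_contraction (θ := 1 / 1000) (M := 3000 + |μ|)
      (d := fun n => |coeffA (n + 2) - 2368| + |coeffB (n + 2) - 752| + |coeffC (n + 2) - 16|)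
      (by norm_num) (by norm_num) (fun n => abs_nonneg _) ?_ ?_ ?_
    · obtain ⟨N, hN⟩ := eventually_atTop.1 hlarge
      refine eventually_atTop.2 ⟨N + 2, fun n hn => ?_⟩
      obtain ⟨k, rfl⟩ := Nat.exists_eq_add_of_le' (show 2 ≤ n by omega)
      exact (abs_sub _ _).trans (by gcongr; exact (hN k (by omega)).2)
    · have := (((hA.sub_const 2368).abs.add (hB.sub_const 752).abs).add (hC.sub_const 16).abs)
      simpa using this
    · obtain ⟨N, hN⟩ := eventually_atTop.1 hlarge
      refine eventually_atTop.2 ⟨N + 2, fun n hn => ?_⟩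
      obtain ⟨k, rfl⟩ := Nat.exists_eq_add_of_le' (show 2 ≤ n by omega)
      have h := dominant_step (hN k (by omega)).1 (hN (k + 1) (by omega)).1 hμabs hroot'
        (hrec (k + 2))
      refine h.trans ?_
      exact add_le_add (mul_le_mul_of_nonneg_left (le_add_of_nonneg_right (abs_nonneg _))
        (by norm_num)) le_rfl
  have h := tendsto_sub_nhds_zero_iff.1 ((tendsto_zero_iff_abs_tendsto_zero _).2 hlim)
  exact (tendsto_add_atTop_iff_nat 2).1 h

/-- The ratio of consecutive terms of a positive, slowly growing solution tends to the positive
root: read backwards, the recurrence gives `ρ = (B + C / ρ₋) / (A + ρ₊)`. -/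
theorem IsSolution.tendsto_ratio_of_growth {x : ℕ → ℝ} (hx : IsSolution x)
    (h : ∀ n, |x (n + 2)| ≤ 10 * max |x (n + 1)| |x n|) (hpos : ∀ n, 0 < x (n + 1)) {μ : ℝ}
    (hμ : 1 / 4 ≤ μ) (hμ' : μ ≤ 1 / 2) (hroot : μ ^ 3 + 2368 * μ ^ 2 - 752 * μ - 16 = 0) :
    Tendsto (fun n => x (n + 1) / x n) atTop (𝓝 μ) := by
  set ρ : ℕ → ℝ := fun n => x (n + 2) / x (n + 1) with hρ
  have hρ0 (n : ℕ) : 0 < ρ n := div_pos (hpos (n + 1)) (hpos n)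
  have hrec (n : ℕ) :
      ρ (n + 1) * (coeffA (n + 1) + ρ (n + 2)) = coeffB (n + 1) + coeffC (n + 1) * (ρ n)⁻¹ := by
    have h := hx.eq (n + 1)
    have n2 := (hpos n).ne'
    have n3 := (hpos (n + 1)).ne'
    have n4 := (hpos (n + 2)).ne'
    simp only [hρ, add_assoc, Nat.reduceAdd] at *
    field_simp
    linear_combination h
  have hA := ((tendsto_add_atTop_iff_nat 1).2 tendsto_coeffA)
  have hB := ((tendsto_add_atTop_iff_nat 1).2 tendsto_coeffB)
  have hC := ((tendsto_add_atTop_iff_nat 1).2 tendsto_coeffC)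
  have hA1 := hA.eventually_const_lt (show (2367 : ℝ) < 2368 by norm_num)
  have hlow : ∀ᶠ n in atTop, 1 / 4 ≤ ρ (n + 1) := by
    filter_upwards [hA1, hA.eventually_lt_const (show (2368 : ℝ) < 2369 by norm_num),
      hB.eventually_const_lt (show (751 : ℝ) < 752 by norm_num)] with n ha ha' hb
    have h3 := h (n + 2)
    rw [abs_of_pos (hpos (n + 3)), abs_of_pos (hpos (n + 2)), abs_of_pos (hpos (n + 1))] at h3
    have e := hx.eq (n + 1)
    have hC0 := mul_nonneg (coeffC_nonneg (n + 1)) (hpos n).le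
    have p2 := hpos (n + 1)
    have p3 := hpos (n + 2)
    change 1 / 4 ≤ x (n + 3) / x (n + 2)
    rw [le_div_iff₀ p2]
    simp only [add_assoc, Nat.reduceAdd] at *
    rcases le_total (x (n + 2)) (x (n + 3)) with hle | hle
    · linarith
    · rw [max_eq_right hle] at h3
      nlinarith
  have hup : ∀ᶠ n in atTop, ρ (n + 2) ≤ 1 / 2 := by
    filter_upwards [hlow, (tendsto_add_atTop_nat 1).eventually hA1,
      (tendsto_add_atTop_nat 1).eventually
        (hB.eventually_lt_const (show (752 : ℝ) < 753 by norm_num)),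
      (tendsto_add_atTop_nat 1).eventually
        (hC.eventually_lt_const (show (16 : ℝ) < 17 by norm_num))] with n hl ha hb hc
    have e := hrec (n + 1)
    have hC0 := coeffC_nonneg (n + 1 + 1)
    have hi : (ρ (n + 1))⁻¹ ≤ 4 := by
      rw [inv_le_comm₀ (hρ0 _) (by norm_num)]; linarith
    have hCi : coeffC (n + 1 + 1) * (ρ (n + 1))⁻¹ ≤ 17 * 4 := by
      have := (inv_pos.2 (hρ0 (n + 1))).le
      gcongr
    have p2 := hρ0 (n + 2)
    have p3 := hρ0 (n + 3)
    simp only [add_assoc, Nat.reduceAdd] at *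
    nlinarith
  have hlim : Tendsto (fun n => |ρ n - μ|) atTop (𝓝 0) := by
    refine tendsto_zero_of_contraction (θ := 3 / 20) (M := 1)
      (d := fun n => |coeffA (n + 2) - 2368| + |coeffB (n + 2) - 752| + |coeffC (n + 2) - 16|)
      (by norm_num) (by norm_num) (fun n => abs_nonneg _) ?_ ?_ ?_
    · obtain ⟨N, hN⟩ := eventually_atTop.1 hup
      refine eventually_atTop.2 ⟨N + 2, fun n hn => ?_⟩
      obtain ⟨k, rfl⟩ := Nat.exists_eq_add_of_le' (show 2 ≤ n by omega)
      have := hN k (by omega)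
      rw [abs_le]
      constructor <;> linarith [hρ0 (k + 2)]
    · have hA := ((tendsto_add_atTop_iff_nat 2).2 tendsto_coeffA)
      have hB := ((tendsto_add_atTop_iff_nat 2).2 tendsto_coeffB)
      have hC := ((tendsto_add_atTop_iff_nat 2).2 tendsto_coeffC)
      have := (((hA.sub_const 2368).abs.add (hB.sub_const 752).abs).add (hC.sub_const 16).abs)
      simpa using this
    · filter_upwards [hlow, (tendsto_add_atTop_nat 1).eventually hA1] with n hl ha
      have e := hrec (n + 1)
      have p3 := hρ0 (n + 3)
      simp only [add_assoc, Nat.reduceAdd] at *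
      have hl' : 1 / 4 ≤ |ρ (n + 1)| := hl.trans (le_abs_self _)
      have hμabs : 1 / 4 ≤ |μ| := hμ.trans (le_abs_self _)
      have d₁ : |(ρ (n + 1))⁻¹ - μ⁻¹| ≤ 16 * |ρ (n + 1) - μ| :=
        (abs_inv_sub_inv_le (by norm_num) hl' hμabs).trans_eq (by ring)
      have b₁ : |(ρ (n + 1))⁻¹| ≤ 4 := (abs_inv_le (by norm_num) hl').trans_eq (by norm_num)
      have hμ0 : μ ≠ 0 := by linarith
      have hroot' : 752 + 16 * μ⁻¹ = μ * (2368 + μ) := by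
        field_simp; linear_combination -hroot
      have e' : (ρ (n + 2) - μ) * (coeffA (n + 2) + ρ (n + 3)) =
          (coeffB (n + 2) - 752) + (coeffC (n + 2) - 16) * (ρ (n + 1))⁻¹
            + 16 * ((ρ (n + 1))⁻¹ - μ⁻¹) - μ * (coeffA (n + 2) - 2368)
            - μ * (ρ (n + 3) - μ) := by
        linear_combination e + hroot'
      have t₁ : |(coeffC (n + 2) - 16) * (ρ (n + 1))⁻¹| ≤ |coeffC (n + 2) - 16| * 4 := by
        rw [abs_mul]; gcongr
      have t₂ : |16 * ((ρ (n + 1))⁻¹ - μ⁻¹)| ≤ 16 * (16 * |ρ (n + 1) - μ|) := by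
        rw [abs_mul, abs_of_pos (by norm_num : (0 : ℝ) < 16)]; gcongr
      have hμ1 : |μ| ≤ 1 := by rw [abs_of_pos (by linarith)]; linarith
      have t₃ : |μ * (coeffA (n + 2) - 2368)| ≤ |coeffA (n + 2) - 2368| := by
        rw [abs_mul]; exact mul_le_of_le_one_left (abs_nonneg _) hμ1
      have t₄ : |μ * (ρ (n + 3) - μ)| ≤ |ρ (n + 3) - μ| := by
        rw [abs_mul]; exact mul_le_of_le_one_left (abs_nonneg _) hμ1
      have hle : |ρ (n + 2) - μ| * 2367 ≤ |coeffB (n + 2) - 752|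
          + |coeffC (n + 2) - 16| * 4 + 16 * (16 * |ρ (n + 1) - μ|)
          + |coeffA (n + 2) - 2368| + |ρ (n + 3) - μ| := by
        calc |ρ (n + 2) - μ| * 2367 ≤ |ρ (n + 2) - μ| * |coeffA (n + 2) + ρ (n + 3)| := by
              gcongr
              exact (by linarith : (2367 : ℝ) ≤ coeffA (n + 2) + ρ (n + 3)).trans (le_abs_self _)
          _ = |(ρ (n + 2) - μ) * (coeffA (n + 2) + ρ (n + 3))| := (abs_mul _ _).symm
          _ ≤ _ := by
              rw [e']
              refine (abs_sub _ _).trans (add_le_add ((abs_sub _ _).trans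
                (add_le_add ((abs_add_le _ _).trans (add_le_add ((abs_add_le _ _).trans
                (add_le_add le_rfl t₁)) t₂)) t₃)) t₄)
      have := abs_nonneg (ρ n - μ)
      have := abs_nonneg (ρ (n + 1) - μ)
      have := abs_nonneg (ρ (n + 3) - μ)
      have := abs_nonneg (coeffA (n + 2) - 2368)
      have := abs_nonneg (coeffB (n + 2) - 752)
      have := abs_nonneg (coeffC (n + 2) - 16)
      linarith
  have h := tendsto_sub_nhds_zero_iff.1 ((tendsto_zero_iff_abs_tendsto_zero _).2 hlim)
  exact (tendsto_add_atTop_iff_nat 1).1 h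

/-! ### The contiguity system and its exterior square -/

/-- The first-order system (valid from `n = 1` on) satisfied by the three very-well-poised series
`wellPoisedSeries k`, `k = 0, 1, 2`, and by the coefficients of `1`, `ζ(3)`, `ζ(5)` in them. -/
structure IsContiguous (a b c : ℕ → ℝ) : Prop where
  fst (n : ℕ) (hn : 1 ≤ n) : a (n + 1) =
    (302 * n ^ 4 + 360 * n ^ 3 + 215 * n ^ 2 + 68 * n + 9) / (n + 1) ^ 4 * a n
      + (262 * n ^ 3 + 557 * n ^ 2 + 230 * n + 33) / (n + 1) ^ 5 * b n
      - 196 * n / (n + 1) ^ 5 * c n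
  snd (n : ℕ) (hn : 1 ≤ n) : b (n + 1) =
    -((98 * n ^ 4 + 110 * n ^ 3 + 60 * n ^ 2 + 17 * n + 2) / (n + 1) ^ 2 * a n)
      - (90 * n ^ 3 + 192 * n ^ 2 + 81 * n + 12) / (n + 1) ^ 3 * b n
      + 66 * n / (n + 1) ^ 3 * c n
  thd (n : ℕ) (hn : 1 ≤ n) : c (n + 1) =
    n * (33 * n ^ 3 + 32 * n ^ 2 + 13 * n + 2) * a n
      + (34 * n ^ 3 + 73 * n ^ 2 + 32 * n + 5) / (n + 1) * b n
      - 24 * n / (n + 1) * c n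

section Minors

variable {a b c a' b' c' : ℕ → ℝ}

theorem IsContiguous.minor_fst_snd (h : IsContiguous a b c) (h' : IsContiguous a' b' c') (n : ℕ)
    (hn : 1 ≤ n) : a (n + 1) * b' (n + 1) - b (n + 1) * a' (n + 1) =
      -((1504 * n ^ 4 + 2466 * n ^ 3 + 1492 * n ^ 2 + 398 * n + 42) / (n + 1) ^ 4
        * (a n * b' n - b n * a' n))
      + n * (724 * n ^ 2 + 752 * n + 202) / (n + 1) ^ 5 * (a n * c' n - c n * a' n)
      - 174 * n * (2 * n + 1) / (n + 1) ^ 6 * (b n * c' n - c n * b' n) := by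
  rw [h.fst n hn, h.snd n hn, h'.fst n hn, h'.snd n hn]
  have : (n : ℝ) + 1 ≠ 0 := by positivity
  field_simp
  ring

theorem IsContiguous.minor_fst_thd (h : IsContiguous a b c) (h' : IsContiguous a' b' c') (n : ℕ)
    (hn : 1 ≤ n) : a (n + 1) * c' (n + 1) - c (n + 1) * a' (n + 1) =
      (1622 * n ^ 4 + 2655 * n ^ 3 + 1603 * n ^ 2 + 427 * n + 45) / (n + 1) ^ 2
        * (a n * b' n - b n * a' n)
      - n * (780 * n ^ 2 + 808 * n + 216) / (n + 1) ^ 3 * (a n * c' n - c n * a' n)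
      + 188 * n * (2 * n + 1) / (n + 1) ^ 4 * (b n * c' n - c n * b' n) := by
  rw [h.fst n hn, h.thd n hn, h'.fst n hn, h'.thd n hn]
  have : (n : ℝ) + 1 ≠ 0 := by positivity
  field_simp
  ring

theorem IsContiguous.minor_snd_thd (h : IsContiguous a b c) (h' : IsContiguous a' b' c') (n : ℕ)
    (hn : 1 ≤ n) : b (n + 1) * c' (n + 1) - c (n + 1) * b' (n + 1) =
      -((362 * n ^ 4 + 592 * n ^ 3 + 357 * n ^ 2 + 95 * n + 10) * (a n * b' n - b n * a' n))
      + n * (174 * n ^ 2 + 180 * n + 48) / (n + 1) * (a n * c' n - c n * a' n)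
      - 42 * n * (2 * n + 1) / (n + 1) ^ 2 * (b n * c' n - c n * b' n) := by
  rw [h.snd n hn, h.thd n hn, h'.snd n hn, h'.thd n hn]
  have : (n : ℝ) + 1 ≠ 0 := by positivity
  field_simp
  ring

/-- The leading minors of two solutions of the contiguity system satisfy the third-order
difference equation. -/
theorem IsContiguous.minor_recurrence (h : IsContiguous a b c) (h' : IsContiguous a' b' c')
    {x : ℕ → ℝ} (hx : ∀ n, 1 ≤ n → x n = a n * b' n - b n * a' n) (n : ℕ) (hn : 1 ≤ n) :
    c₃ ((n : ℝ) + 2) * x (n + 3) + c₂ ((n : ℝ) + 2) * x (n + 2)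
      + c₁ ((n : ℝ) + 2) * x (n + 1) + c₀ ((n : ℝ) + 2) * x n = 0 := by
  have e3 := h.minor_fst_snd h' (n + 2) (by omega)
  have e2 := h.minor_fst_snd h' (n + 1) (by omega)
  have f2 := h.minor_fst_thd h' (n + 1) (by omega)
  have g2 := h.minor_snd_thd h' (n + 1) (by omega)
  have e1 := h.minor_fst_snd h' n hn
  have f1 := h.minor_fst_thd h' n hn
  have g1 := h.minor_snd_thd h' n hn
  rw [hx n hn, hx (n + 1) (by omega), hx (n + 2) (by omega), hx (n + 3) (by omega)]
  simp only [add_assoc, Nat.reduceAdd, Nat.cast_add, Nat.cast_ofNat, Nat.cast_one] at *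
  rw [e3, e2, f2, g2, e1, f1, g1]
  generalize a n * b' n - b n * a' n = u
  generalize a n * c' n - c n * a' n = v
  generalize b n * c' n - c n * b' n = w
  have hn' : (1 : ℝ) ≤ n := by exact_mod_cast hn
  generalize (n : ℝ) = t at *
  norm_num
  have h1 : t + 1 ≠ 0 := by linarith
  have h2 : t + 2 ≠ 0 := by linarith
  have h3 : t + 3 ≠ 0 := by linarith
  unfold c₃ c₂ c₁ c₀ a₁ a₂ a₀
  field_simp
  ring

end Minors

/-! ### The very-well-poised series -/

/-- The summand of the `0`-th very-well-poised series without its factor `2 t + n`: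
`n!⁴ ∏_{j=1}^{n} (t - j)(t + n + j) / ∏_{j=0}^{n} (t + j)⁶`, with `∏_{j=1}^{n} (t + n + j)` written
as a quotient of two rising factorials. -/
noncomputable def kernel (n : ℕ) (t : ℝ) : ℝ :=
  (n.factorial : ℝ) ^ 4 * (∏ j ∈ Finset.range n, (t - (j + 1)))
    * (∏ j ∈ Finset.range (2 * n + 1), (t + j)) / (∏ j ∈ Finset.range (n + 1), (t + j)) ^ 7

/-- The summand of the `k`-th very-well-poised series. It is antisymmetric under `t ↦ -n - t`, so
only odd zeta values occur. -/
noncomputable def wellPoisedTerm (k n : ℕ) (t : ℝ) : ℝ :=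
  (2 * t + n) * (t * (t + n)) ^ k * kernel n t

/-- The `k`-th very-well-poised series; its summands with `t ≤ n` vanish. -/
noncomputable def wellPoisedSeries (k n : ℕ) : ℝ := ∑' i : ℕ, wellPoisedTerm k n ((i : ℝ) + 1)

theorem prod_range_add_pos {t : ℝ} (ht : 0 < t) (m : ℕ) : 0 < ∏ j ∈ Finset.range m, (t + j) :=
  Finset.prod_pos fun j _ => by positivity

theorem kernel_succ (n : ℕ) {t : ℝ} (ht : 0 < t) : kernel (n + 1) t =
    (n + 1) ^ 4 * (t - n - 1) * (t + 2 * n + 1) * (t + 2 * n + 2) / (t + n + 1) ^ 7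
      * kernel n t := by
  have h1 := (prod_range_add_pos ht (n + 1)).ne'
  have h2 : t + n + 1 ≠ 0 := by positivity
  unfold kernel
  rw [show 2 * (n + 1) + 1 = 2 * n + 1 + 1 + 1 by ring, Finset.prod_range_succ _ (2 * n + 1 + 1),
    Finset.prod_range_succ _ (2 * n + 1), Finset.prod_range_succ _ n,
    Finset.prod_range_succ _ (n + 1), Nat.factorial_succ]
  have h3 : t + ((n + 1 : ℕ) : ℝ) = t + n + 1 := by push_cast; ring
  rw [h3, mul_pow]
  push_cast
  field_simp
  ring

theorem kernel_add_one (n : ℕ) {t : ℝ} (ht : 0 < t) : (t - n) * kernel n (t + 1) =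
    t ^ 7 * (t + 2 * n + 1) / (t + n + 1) ^ 7 * kernel n t := by
  have hP (m : ℕ) : ∏ j ∈ Finset.range m, (t + 1 + (j : ℝ)) =
      (∏ j ∈ Finset.range m, (t + j)) * (t + m) / t := by
    rw [eq_div_iff ht.ne', ← Finset.prod_range_succ (fun j : ℕ => t + (j : ℝ)),
      Finset.prod_range_succ']
    simp [add_assoc, add_comm (1 : ℝ)]
  have hD : (t - n) * ∏ j ∈ Finset.range n, (t + 1 - ((j : ℝ) + 1)) =
      t * ∏ j ∈ Finset.range n, (t - ((j : ℝ) + 1)) := by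
    have e : ∏ j ∈ Finset.range n, (t + 1 - ((j : ℝ) + 1)) = ∏ j ∈ Finset.range n, (t - j) :=
      Finset.prod_congr rfl fun j _ => by ring
    rw [e, mul_comm, ← Finset.prod_range_succ (fun j : ℕ => t - (j : ℝ)),
      Finset.prod_range_succ', mul_comm]
    simp
  have h1 := (prod_range_add_pos ht (n + 1)).ne'
  have h2 : t + n + 1 ≠ 0 := by positivity
  unfold kernel
  rw [hP, hP]
  have h3 : t + ((n + 1 : ℕ) : ℝ) = t + n + 1 := by push_cast; ring
  rw [h3]
  push_cast
  set D := ∏ j ∈ Finset.range n, (t + 1 - ((j : ℝ) + 1)) with hDdef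
  set D' := ∏ j ∈ Finset.range n, (t - ((j : ℝ) + 1))
  field_simp
  linear_combination (t + (2 * n + 1)) * hD

theorem kernel_eq_zero {n i : ℕ} (h : i < n) : kernel n ((i : ℝ) + 1) = 0 := by
  unfold kernel
  rw [Finset.prod_eq_zero (Finset.mem_range.2 h) (by simp)]
  simp

/-- The main estimate: every factor `t - j` is at most `t + j`, and every factor `t + n + j` is at
most `2 (t + j)`. -/
theorem abs_kernel_le {n : ℕ} {t : ℝ} (ht : (n : ℝ) + 1 ≤ t) :
    |kernel n t| ≤
      2 ^ n * ((n.factorial : ℝ) / ∏ j ∈ Finset.range n, (t + 1 + j)) ^ 4 / t ^ 6 := by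
  have hn : (0 : ℝ) ≤ n := n.cast_nonneg
  have ht0 : 0 < t := by linarith
  set S := ∏ j ∈ Finset.range n, (t + 1 + (j : ℝ)) with hS
  have hS0 : 0 < S := prod_range_add_pos (by linarith) n
  set D := ∏ j ∈ Finset.range n, (t - ((j : ℝ) + 1)) with hD
  set Q := ∏ j ∈ Finset.range n, (t + n + 1 + (j : ℝ)) with hQ
  have hfac (j : ℕ) (hj : j ∈ Finset.range n) : (j : ℝ) + 1 ≤ n := by
    exact_mod_cast Finset.mem_range.1 hj
  have hD0 : 0 ≤ D := Finset.prod_nonneg fun j hj => by linarith [hfac j hj]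
  have hDS : D ≤ S := Finset.prod_le_prod (fun j hj => by linarith [hfac j hj])
    fun j _ => by linarith [(j.cast_nonneg : (0 : ℝ) ≤ j)]
  have hQ0 : 0 ≤ Q := Finset.prod_nonneg fun j _ => by positivity
  have hQS : Q ≤ 2 ^ n * S := by
    have : Q ≤ ∏ j ∈ Finset.range n, (2 * (t + 1 + (j : ℝ))) :=
      Finset.prod_le_prod (fun j _ => by positivity) fun j _ => by
        linarith [(j.cast_nonneg : (0 : ℝ) ≤ j)]
    simpa [Finset.prod_mul_distrib] using this
  have hP1 : ∏ j ∈ Finset.range (n + 1), (t + (j : ℝ)) = t * S := by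
    rw [Finset.prod_range_succ', hS, mul_comm]
    simp [add_assoc, add_comm (1 : ℝ)]
  have hP2 : ∏ j ∈ Finset.range (2 * n + 1), (t + (j : ℝ)) = t * S * Q := by
    rw [show 2 * n + 1 = (n + 1) + n by ring, Finset.prod_range_add, hP1, hQ]
    congr 1
    exact Finset.prod_congr rfl fun j _ => by push_cast; ring
  have hval : kernel n t = (n.factorial : ℝ) ^ 4 * D * Q / (t ^ 6 * S ^ 6) := by
    unfold kernel
    rw [hP1, hP2, ← hD]
    field_simp
  rw [hval, abs_of_nonneg (by positivity)]
  calc (n.factorial : ℝ) ^ 4 * D * Q / (t ^ 6 * S ^ 6)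
      ≤ (n.factorial : ℝ) ^ 4 * S * (2 ^ n * S) / (t ^ 6 * S ^ 6) := by gcongr
    _ = _ := by field_simp

theorem abs_kernel_le_pow {n : ℕ} (hn : 1 ≤ n) (i : ℕ) :
    |kernel n ((i : ℝ) + 1)| ≤ 2 ^ n * (n.factorial : ℝ) ^ 4 / ((i : ℝ) + 1) ^ 10 := by
  rcases lt_or_ge i n with hi | hi
  · rw [kernel_eq_zero hi, abs_zero]; positivity
  · have ht : (n : ℝ) + 1 ≤ (i : ℝ) + 1 := by gcongr
    refine (abs_kernel_le ht).trans ?_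
    have hS : (i : ℝ) + 1 ≤ ∏ j ∈ Finset.range n, ((i : ℝ) + 1 + 1 + j) := by
      obtain ⟨m, rfl⟩ := Nat.exists_eq_add_of_le' hn
      rw [Finset.prod_range_succ']
      have h1 : 1 ≤ ∏ j ∈ Finset.range m, ((i : ℝ) + 1 + 1 + ((j + 1 : ℕ) : ℝ)) :=
        Finset.one_le_prod fun j _ => by
          have : (0 : ℝ) ≤ i := i.cast_nonneg
          have : (0 : ℝ) ≤ ((j + 1 : ℕ) : ℝ) := Nat.cast_nonneg _
          linarith
      have h2 : (0 : ℝ) ≤ (i : ℝ) + 1 := by positivity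
      push_cast at h1 ⊢
      nlinarith
    have hi0 : (0 : ℝ) < (i : ℝ) + 1 := by positivity
    calc _ ≤ 2 ^ n * ((n.factorial : ℝ) / ((i : ℝ) + 1)) ^ 4 / ((i : ℝ) + 1) ^ 6 := by gcongr
      _ = _ := by field_simp

theorem abs_kernel_le_centralBinom (n i : ℕ) :
    |kernel n ((i : ℝ) + 1)| ≤ 2 ^ n / (n.centralBinom : ℝ) ^ 4 / ((i : ℝ) + 1) ^ 6 := by
  rcases lt_or_ge i n with hi | hi
  · rw [kernel_eq_zero hi, abs_zero]; positivity
  · have hc : (0 : ℝ) < n.centralBinom := by exact_mod_cast n.centralBinom_pos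
    refine (abs_kernel_le (by gcongr)).trans ?_
    have hS : (n.factorial : ℝ) * n.centralBinom ≤
        ∏ j ∈ Finset.range n, ((i : ℝ) + 1 + 1 + j) := by
      have h : ((n + 1).ascFactorial n : ℝ) = n.factorial * n.centralBinom := by
        rw [Nat.ascFactorial_eq_factorial_mul_choose, Nat.centralBinom_eq_two_mul_choose, two_mul]
        push_cast; rfl
      rw [← h, Nat.ascFactorial_eq_prod_range]
      push_cast
      refine Finset.prod_le_prod (fun j _ => by positivity) fun j _ => ?_
      have : (n : ℝ) ≤ i := by exact_mod_cast hi
      linarith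
    calc _ ≤ 2 ^ n * ((n.factorial : ℝ) / (n.factorial * n.centralBinom)) ^ 4
          / ((i : ℝ) + 1) ^ 6 := by gcongr
      _ = _ := by field_simp

theorem abs_wellPoisedTerm_le (k n i : ℕ) : |wellPoisedTerm k n ((i : ℝ) + 1)| ≤
    3 * 2 ^ k * ((i : ℝ) + 1) ^ (2 * k + 1) * |kernel n ((i : ℝ) + 1)| := by
  rcases lt_or_ge i n with hi | hi
  · simp [wellPoisedTerm, kernel_eq_zero hi]
  · have hn : (n : ℝ) ≤ i := by exact_mod_cast hi
    rw [wellPoisedTerm, abs_mul, abs_of_nonneg (by positivity)]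
    refine mul_le_mul_of_nonneg_right ?_ (abs_nonneg _)
    calc (2 * ((i : ℝ) + 1) + n) * (((i : ℝ) + 1) * ((i : ℝ) + 1 + n)) ^ k
        ≤ (3 * ((i : ℝ) + 1)) * (((i : ℝ) + 1) * (2 * ((i : ℝ) + 1))) ^ k := by
          gcongr <;> linarith
      _ = _ := by simp only [mul_pow]; ring

theorem summable_one_div_succ_pow {m : ℕ} (hm : 2 ≤ m) :
    Summable fun i : ℕ => 1 / ((i : ℝ) + 1) ^ m := by
  have h := (summable_nat_add_iff 1).2 (Real.summable_one_div_nat_pow.2 (show 1 < m by omega))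
  simpa using h

theorem summable_wellPoisedTerm {k n : ℕ} (hk : k ≤ 2) (hn : 1 ≤ n) :
    Summable fun i : ℕ => wellPoisedTerm k n ((i : ℝ) + 1) := by
  refine Summable.of_norm_bounded
    ((summable_one_div_succ_pow (le_refl 2)).mul_left (3 * 2 ^ k * (2 ^ n * (n.factorial : ℝ) ^ 4)))
    fun i => ?_
  have h1 : (1 : ℝ) ≤ (i : ℝ) + 1 := by linarith [(i.cast_nonneg : (0 : ℝ) ≤ i)]
  calc ‖wellPoisedTerm k n ((i : ℝ) + 1)‖
      ≤ 3 * 2 ^ k * ((i : ℝ) + 1) ^ (2 * k + 1) * |kernel n ((i : ℝ) + 1)| :=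
        abs_wellPoisedTerm_le k n i
    _ ≤ 3 * 2 ^ k * ((i : ℝ) + 1) ^ 8 * (2 ^ n * (n.factorial : ℝ) ^ 4 / ((i : ℝ) + 1) ^ 10) := by
        gcongr ?_ * ?_ * ?_
        · exact pow_le_pow_right₀ h1 (by omega)
        · exact abs_kernel_le_pow hn i
    _ = _ := by field_simp

theorem tendsto_pow_mul_kernel {n : ℕ} (hn : 1 ≤ n) {j : ℕ} (hj : j ≤ 8) :
    Tendsto (fun i : ℕ => ((i : ℝ) + 1) ^ j * kernel n ((i : ℝ) + 1)) atTop (𝓝 0) := by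
  have h0 := ((summable_one_div_succ_pow (le_refl 2)).mul_left
    (2 ^ n * (n.factorial : ℝ) ^ 4)).tendsto_atTop_zero
  refine squeeze_zero_norm (fun i => ?_) h0
  have h1 : (1 : ℝ) ≤ (i : ℝ) + 1 := by linarith [(i.cast_nonneg : (0 : ℝ) ≤ i)]
  rw [norm_mul, norm_pow, Real.norm_of_nonneg (by positivity), Real.norm_eq_abs]
  calc ((i : ℝ) + 1) ^ j * |kernel n ((i : ℝ) + 1)|
      ≤ ((i : ℝ) + 1) ^ 8 * (2 ^ n * (n.factorial : ℝ) ^ 4 / ((i : ℝ) + 1) ^ 10) := by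
        gcongr ?_ * ?_
        · exact pow_le_pow_right₀ h1 hj
        · exact abs_kernel_le_pow hn i
    _ = _ := by field_simp

/-- Creative telescoping: a certificate `N` of degree `5` in `t` turns an identity of summands into
a contiguity relation of the series. -/
theorem wellPoisedSeries_succ {k n : ℕ} (hk : k ≤ 2) (hn : 1 ≤ n) (α β γ : ℝ) {N : ℝ → ℝ}
    (r₀ r₁ r₂ r₃ r₄ r₅ : ℝ)
    (hN : ∀ t, N t = r₀ + r₁ * t + r₂ * t ^ 2 + r₃ * t ^ 3 + r₄ * t ^ 4 + r₅ * t ^ 5)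
    (h : ∀ t, 0 < t → wellPoisedTerm k (n + 1) t =
      α * wellPoisedTerm 0 n t + β * wellPoisedTerm 1 n t + γ * wellPoisedTerm 2 n t
        + (N (t + 1) * ((t - n) * kernel n (t + 1)) - N t * ((t - n - 1) * kernel n t))) :
    wellPoisedSeries k (n + 1) = α * wellPoisedSeries 0 n + β * wellPoisedSeries 1 n
      + γ * wellPoisedSeries 2 n := by
  have s0 := (summable_wellPoisedTerm (k := 0) (by omega) hn).hasSum.mul_left α
  have s1 := (summable_wellPoisedTerm (k := 1) (by omega) hn).hasSum.mul_left β
  have s2 := (summable_wellPoisedTerm (k := 2) (by omega) hn).hasSum.mul_left γ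
  have s := (summable_wellPoisedTerm (k := k) (n := n + 1) hk (by omega)).hasSum
  have hdiff := s.sub ((s0.add s1).add s2)
  set T : ℕ → ℝ := fun i =>
    N ((i : ℝ) + 1) * (((i : ℝ) + 1 - n - 1) * kernel n ((i : ℝ) + 1)) with hT
  have hT0 : T 0 = 0 := by
    have := kernel_eq_zero (n := n) (i := 0) (by omega)
    simp only [hT, this, mul_zero]
  have hTlim : Tendsto T atTop (𝓝 0) := by
    have l (j : ℕ) (hj : j ≤ 8) (r : ℝ) := (tendsto_pow_mul_kernel hn hj).const_mul r
    have := ((((((l 6 (by norm_num) r₅).add (l 5 (by norm_num) (r₄ - (n + 1) * r₅))).add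
      (l 4 (by norm_num) (r₃ - (n + 1) * r₄))).add (l 3 (by norm_num) (r₂ - (n + 1) * r₃))).add
      (l 2 (by norm_num) (r₁ - (n + 1) * r₂))).add (l 1 (by norm_num) (r₀ - (n + 1) * r₁))).add
      (l 0 (by norm_num) (-(n + 1) * r₀))
    simp only [mul_zero, add_zero] at this
    refine this.congr fun i => ?_
    simp only [hT, hN]
    ring
  have htel := hdiff.tendsto_sum_nat
  have hsum (m : ℕ) : ∑ i ∈ Finset.range m, (wellPoisedTerm k (n + 1) ((i : ℝ) + 1)
      - (α * wellPoisedTerm 0 n ((i : ℝ) + 1) + β * wellPoisedTerm 1 n ((i : ℝ) + 1)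
        + γ * wellPoisedTerm 2 n ((i : ℝ) + 1))) = T m := by
    rw [← sub_zero (T m), ← hT0, ← Finset.sum_range_sub]
    refine Finset.sum_congr rfl fun i _ => ?_
    rw [h _ (by positivity)]
    simp only [hT]
    push_cast
    ring_nf
  have := tendsto_nhds_unique (htel.congr hsum) hTlim
  unfold wellPoisedSeries
  linarith

/-- The contiguity relations of the very-well-poised series. The certificates `N` are the solutions
of the linear system that the method of undetermined coefficients gives. -/
theorem isContiguous_wellPoisedSeries : IsContiguous (wellPoisedSeries 0) (wellPoisedSeries 1)
    (wellPoisedSeries 2) where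
  fst n hn := by
    rw [wellPoisedSeries_succ (k := 0) (n := n)
      (N := fun t => -(((306 * n ^ 5 + 378 * n ^ 4 + 247 * n ^ 3 + 96 * n ^ 2 + 21 * n + 2)
        + (1152 * n ^ 4 + 1018 * n ^ 3 + 453 * n ^ 2 + 108 * n + 11) * t
        + (1795 * n ^ 3 + 1074 * n ^ 2 + 291 * n + 32) * t ^ 2
        + (1437 * n ^ 2 + 522 * n + 65) * t ^ 3
        + (588 * n + 98) * t ^ 4 + 98 * t ^ 5) / (n + 1) ^ 5))
      (by norm_num) hn
      ((302 * n ^ 4 + 360 * n ^ 3 + 215 * n ^ 2 + 68 * n + 9) / (n + 1) ^ 4)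
      ((262 * n ^ 3 + 557 * n ^ 2 + 230 * n + 33) / (n + 1) ^ 5)
      (-(196 * n / (n + 1) ^ 5))
      (-((306 * n ^ 5 + 378 * n ^ 4 + 247 * n ^ 3 + 96 * n ^ 2 + 21 * n + 2) / (n + 1) ^ 5))
      (-((1152 * n ^ 4 + 1018 * n ^ 3 + 453 * n ^ 2 + 108 * n + 11) / (n + 1) ^ 5))
      (-((1795 * n ^ 3 + 1074 * n ^ 2 + 291 * n + 32) / (n + 1) ^ 5))
      (-((1437 * n ^ 2 + 522 * n + 65) / (n + 1) ^ 5))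
      (-((588 * n + 98) / (n + 1) ^ 5)) (-(98 / (n + 1) ^ 5)) (fun t => by ring)]
    · ring
    · intro t ht
      have h1 : (n : ℝ) + 1 ≠ 0 := by positivity
      have h2 : t + n + 1 ≠ 0 := by positivity
      simp only [wellPoisedTerm]
      rw [kernel_succ n ht, kernel_add_one n ht]
      generalize kernel n t = K
      push_cast
      generalize (n : ℝ) = n at *
      field_simp
      ring
  snd n hn := by
    rw [wellPoisedSeries_succ (k := 1) (n := n)
      (N := fun t => (n * (98 * n ^ 4 + 110 * n ^ 3 + 60 * n ^ 2 + 17 * n + 2)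
        + (380 * n ^ 4 + 320 * n ^ 3 + 129 * n ^ 2 + 26 * n + 2) * t
        + (600 * n ^ 3 + 351 * n ^ 2 + 90 * n + 9) * t ^ 2
        + (483 * n ^ 2 + 174 * n + 21) * t ^ 3
        + (198 * n + 33) * t ^ 4 + 33 * t ^ 5) / (n + 1) ^ 3)
      (by norm_num) hn
      (-((98 * n ^ 4 + 110 * n ^ 3 + 60 * n ^ 2 + 17 * n + 2) / (n + 1) ^ 2))
      (-((90 * n ^ 3 + 192 * n ^ 2 + 81 * n + 12) / (n + 1) ^ 3))
      (66 * n / (n + 1) ^ 3)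
      (n * (98 * n ^ 4 + 110 * n ^ 3 + 60 * n ^ 2 + 17 * n + 2) / (n + 1) ^ 3)
      ((380 * n ^ 4 + 320 * n ^ 3 + 129 * n ^ 2 + 26 * n + 2) / (n + 1) ^ 3)
      ((600 * n ^ 3 + 351 * n ^ 2 + 90 * n + 9) / (n + 1) ^ 3)
      ((483 * n ^ 2 + 174 * n + 21) / (n + 1) ^ 3)
      ((198 * n + 33) / (n + 1) ^ 3) (33 / (n + 1) ^ 3) (fun t => by ring)]
    · ring
    · intro t ht
      have h1 : (n : ℝ) + 1 ≠ 0 := by positivity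
      have h2 : t + n + 1 ≠ 0 := by positivity
      simp only [wellPoisedTerm]
      rw [kernel_succ n ht, kernel_add_one n ht]
      generalize kernel n t = K
      push_cast
      generalize (n : ℝ) = n at *
      field_simp
      ring
  thd n hn := by
    rw [wellPoisedSeries_succ (k := 2) (n := n)
      (N := fun t => -((n ^ 2 * (33 * n ^ 3 + 32 * n ^ 2 + 13 * n + 2)
        + n * (133 * n ^ 3 + 102 * n ^ 2 + 33 * n + 4) * t
        + (215 * n ^ 3 + 120 * n ^ 2 + 27 * n + 2) * t ^ 2
        + (175 * n ^ 2 + 62 * n + 7) * t ^ 3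
        + (72 * n + 12) * t ^ 4 + 12 * t ^ 5) / (n + 1)))
      (by norm_num) hn
      (n * (33 * n ^ 3 + 32 * n ^ 2 + 13 * n + 2))
      ((34 * n ^ 3 + 73 * n ^ 2 + 32 * n + 5) / (n + 1))
      (-(24 * n / (n + 1)))
      (-(n ^ 2 * (33 * n ^ 3 + 32 * n ^ 2 + 13 * n + 2) / (n + 1)))
      (-(n * (133 * n ^ 3 + 102 * n ^ 2 + 33 * n + 4) / (n + 1)))
      (-((215 * n ^ 3 + 120 * n ^ 2 + 27 * n + 2) / (n + 1)))
      (-((175 * n ^ 2 + 62 * n + 7) / (n + 1)))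
      (-((72 * n + 12) / (n + 1))) (-(12 / (n + 1))) (fun t => by ring)]
    · ring
    · intro t ht
      have h1 : (n : ℝ) + 1 ≠ 0 := by positivity
      have h2 : t + n + 1 ≠ 0 := by positivity
      simp only [wellPoisedTerm]
      rw [kernel_succ n ht, kernel_add_one n ht]
      generalize kernel n t = K
      push_cast
      generalize (n : ℝ) = n at *
      field_simp
      ring

/-! ### Zeta values and the series for `n = 1` -/

theorem hasSum_zetaR {m : ℕ} (hm : 2 ≤ m) :
    HasSum (fun i : ℕ => 1 / ((i : ℝ) + 1) ^ m) (zetaR m) := by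
  have hs := summable_one_div_succ_pow hm
  have h0 : Summable fun i : ℕ => 1 / (i : ℝ) ^ m := Real.summable_one_div_nat_pow.2 (by omega)
  have e : zetaR m = ∑' i : ℕ, 1 / (i : ℝ) ^ m := by
    have : riemannZeta ((m : ℝ) : ℂ) = ((∑' i : ℕ, 1 / (i : ℝ) ^ m : ℝ) : ℂ) := by
      rw [Complex.ofReal_natCast, zeta_nat_eq_tsum_of_gt_one (by omega), Complex.ofReal_tsum]
      push_cast
      rfl
    rw [zetaR, this, Complex.ofReal_re]
  rw [e, h0.tsum_eq_zero_add]
  simpa [show m ≠ 0 by omega] using hs.hasSum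

theorem hasSum_zetaR_sub_one {m : ℕ} (hm : 2 ≤ m) :
    HasSum (fun i : ℕ => 1 / ((i : ℝ) + 1 + 1) ^ m) (zetaR m - 1) := by
  have h := (hasSum_nat_add_iff' 1).2 (hasSum_zetaR hm)
  simpa using h

theorem one_le_zetaR {m : ℕ} (hm : 2 ≤ m) : 1 ≤ zetaR m := by
  have h := (hasSum_zetaR_sub_one hm).nonneg fun i => by positivity
  linarith

theorem zetaR_le_two {m : ℕ} (hm : 2 ≤ m) : zetaR m ≤ 2 := by
  have hle : zetaR m ≤ zetaR (2 : ℕ) := by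
    refine hasSum_le (fun i => ?_) (hasSum_zetaR hm) (hasSum_zetaR le_rfl)
    have h1 : (1 : ℝ) ≤ (i : ℝ) + 1 := by linarith [(i.cast_nonneg : (0 : ℝ) ≤ i)]
    gcongr
  have h2 : zetaR (2 : ℕ) ≤ Real.pi ^ 2 / 6 := by
    have e : zetaR (2 : ℕ) = Real.pi ^ 2 / 6 := by
      rw [zetaR, Nat.cast_ofNat, Complex.ofReal_ofNat, riemannZeta_two]
      exact_mod_cast Complex.ofReal_re _
    exact e.le
  exact hle.trans (h2.trans (by nlinarith [Real.pi_lt_d2, Real.pi_pos]))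

theorem kernel_one {t : ℝ} (ht : 0 < t) : kernel 1 t = (t - 1) * (t + 2) / (t * (t + 1)) ^ 6 := by
  have : t + 1 ≠ 0 := by positivity
  simp only [kernel, Finset.prod_range_succ, Finset.prod_range_zero, Nat.factorial_one]
  norm_num
  field_simp

theorem hasSum_add {m : ℕ} (hm : 2 ≤ m) :
    HasSum (fun i : ℕ => 1 / ((i : ℝ) + 1) ^ m + 1 / ((i : ℝ) + 1 + 1) ^ m)
      (2 * zetaR m - 1) := by
  have h := (hasSum_zetaR hm).add (hasSum_zetaR_sub_one hm)
  rwa [show zetaR m + (zetaR m - 1) = 2 * zetaR m - 1 by ring] at h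

theorem hasSum_sub {m : ℕ} (hm : 2 ≤ m) :
    HasSum (fun i : ℕ => 1 / ((i : ℝ) + 1) ^ m - 1 / ((i : ℝ) + 1 + 1) ^ m) 1 := by
  have h := (hasSum_zetaR hm).sub (hasSum_zetaR_sub_one hm)
  rwa [sub_sub_cancel] at h

/-- The partial fraction expansion of the summand for `n = 1`, summed termwise: odd powers give zeta
values, even powers telescope. -/
theorem wellPoisedSeries_zero_one :
    wellPoisedSeries 0 1 = 18 * zetaR 5 + 66 * zetaR 3 - 98 := by
  have h := (((((hasSum_sub (m := 6) (by norm_num)).mul_left (-2)).add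
    ((hasSum_add (m := 5) (by norm_num)).mul_left 9)).add
    ((hasSum_sub (m := 4) (by norm_num)).mul_left (-21))).add
    ((hasSum_add (m := 3) (by norm_num)).mul_left 33)).add
    ((hasSum_sub (m := 2) (by norm_num)).mul_left (-33))
  have e (i : ℕ) : wellPoisedTerm 0 1 ((i : ℝ) + 1) =
      -2 * (1 / ((i : ℝ) + 1) ^ 6 - 1 / ((i : ℝ) + 1 + 1) ^ 6)
        + 9 * (1 / ((i : ℝ) + 1) ^ 5 + 1 / ((i : ℝ) + 1 + 1) ^ 5)
        + (-21) * (1 / ((i : ℝ) + 1) ^ 4 - 1 / ((i : ℝ) + 1 + 1) ^ 4)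
        + 33 * (1 / ((i : ℝ) + 1) ^ 3 + 1 / ((i : ℝ) + 1 + 1) ^ 3)
        + (-33) * (1 / ((i : ℝ) + 1) ^ 2 - 1 / ((i : ℝ) + 1 + 1) ^ 2) := by
    rw [wellPoisedTerm, kernel_one (by positivity)]
    have h1 : (i : ℝ) + 1 ≠ 0 := by positivity
    have h2 : (i : ℝ) + 1 + 1 ≠ 0 := by positivity
    push_cast
    field_simp
    ring
  rw [wellPoisedSeries, tsum_congr e, h.tsum_eq]
  push_cast
  ring

theorem wellPoisedSeries_one_one : wellPoisedSeries 1 1 = -4 * zetaR 5 - 24 * zetaR 3 + 33 := by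
  have h := ((((hasSum_add (m := 5) (by norm_num)).mul_left (-2)).add
    ((hasSum_sub (m := 4) (by norm_num)).mul_left 7)).add
    ((hasSum_add (m := 3) (by norm_num)).mul_left (-12))).add
    ((hasSum_sub (m := 2) (by norm_num)).mul_left 12)
  have e (i : ℕ) : wellPoisedTerm 1 1 ((i : ℝ) + 1) =
      -2 * (1 / ((i : ℝ) + 1) ^ 5 + 1 / ((i : ℝ) + 1 + 1) ^ 5)
        + 7 * (1 / ((i : ℝ) + 1) ^ 4 - 1 / ((i : ℝ) + 1 + 1) ^ 4)
        + (-12) * (1 / ((i : ℝ) + 1) ^ 3 + 1 / ((i : ℝ) + 1 + 1) ^ 3)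
        + 12 * (1 / ((i : ℝ) + 1) ^ 2 - 1 / ((i : ℝ) + 1 + 1) ^ 2) := by
    rw [wellPoisedTerm, kernel_one (by positivity)]
    have h1 : (i : ℝ) + 1 ≠ 0 := by positivity
    have h2 : (i : ℝ) + 1 + 1 ≠ 0 := by positivity
    push_cast
    field_simp
    ring
  rw [wellPoisedSeries, tsum_congr e, h.tsum_eq]
  push_cast
  ring

theorem wellPoisedSeries_two_one : wellPoisedSeries 2 1 = 10 * zetaR 3 - 12 := by
  have h := (((hasSum_sub (m := 4) (by norm_num)).mul_left (-2)).add
    ((hasSum_add (m := 3) (by norm_num)).mul_left 5)).add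
    ((hasSum_sub (m := 2) (by norm_num)).mul_left (-5))
  have e (i : ℕ) : wellPoisedTerm 2 1 ((i : ℝ) + 1) =
      -2 * (1 / ((i : ℝ) + 1) ^ 4 - 1 / ((i : ℝ) + 1 + 1) ^ 4)
        + 5 * (1 / ((i : ℝ) + 1) ^ 3 + 1 / ((i : ℝ) + 1 + 1) ^ 3)
        + (-5) * (1 / ((i : ℝ) + 1) ^ 2 - 1 / ((i : ℝ) + 1 + 1) ^ 2) := by
    rw [wellPoisedTerm, kernel_one (by positivity)]
    have h1 : (i : ℝ) + 1 ≠ 0 := by positivity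
    have h2 : (i : ℝ) + 1 + 1 ≠ 0 := by positivity
    push_cast
    field_simp
    ring
  rw [wellPoisedSeries, tsum_congr e, h.tsum_eq]
  push_cast
  ring

/-! ### Bounds for the solutions of the contiguity system -/

/-- The contiguity system has a solution with any given initial vector at `n = 1`. -/
theorem exists_isContiguous (α β γ : ℝ) :
    ∃ a b c : ℕ → ℝ, IsContiguous a b c ∧ a 1 = α ∧ b 1 = β ∧ c 1 = γ := by
  let step (n : ℝ) (v : ℝ × ℝ × ℝ) : ℝ × ℝ × ℝ :=
    ((302 * n ^ 4 + 360 * n ^ 3 + 215 * n ^ 2 + 68 * n + 9) / (n + 1) ^ 4 * v.1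
        + (262 * n ^ 3 + 557 * n ^ 2 + 230 * n + 33) / (n + 1) ^ 5 * v.2.1
        - 196 * n / (n + 1) ^ 5 * v.2.2,
      -((98 * n ^ 4 + 110 * n ^ 3 + 60 * n ^ 2 + 17 * n + 2) / (n + 1) ^ 2 * v.1)
        - (90 * n ^ 3 + 192 * n ^ 2 + 81 * n + 12) / (n + 1) ^ 3 * v.2.1
        + 66 * n / (n + 1) ^ 3 * v.2.2,
      n * (33 * n ^ 3 + 32 * n ^ 2 + 13 * n + 2) * v.1
        + (34 * n ^ 3 + 73 * n ^ 2 + 32 * n + 5) / (n + 1) * v.2.1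
        - 24 * n / (n + 1) * v.2.2)
  -- the term of index `0` is irrelevant: the recursion starts at `n = 1`
  let v (n : ℕ) : ℝ × ℝ × ℝ := Nat.rec (α, β, γ) (fun k w => step (k + 1) w) (n - 1)
  have hv (n : ℕ) (hn : 1 ≤ n) : v (n + 1) = step n (v n) := by
    obtain ⟨k, rfl⟩ := Nat.exists_eq_add_of_le' hn
    simp only [v, Nat.add_sub_cancel]
    push_cast
    rfl
  refine ⟨fun n => (v n).1, fun n => (v n).2.1, fun n => (v n).2.2, ⟨?_, ?_, ?_⟩, rfl, rfl, rfl⟩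
  · intro n hn; simp only [hv n hn, step]
  · intro n hn; simp only [hv n hn, step]
  · intro n hn; simp only [hv n hn, step]

/-- Solutions of the contiguity system grow at most like `760 ^ n`, up to the natural powers of
`n`; here `760 = 302 + 262 + 196`. -/
theorem IsContiguous.exists_bound {a b c : ℕ → ℝ} (h : IsContiguous a b c) :
    ∃ W : ℝ, 0 ≤ W ∧ ∀ n : ℕ, 1 ≤ n → |a n| ≤ W * 760 ^ n ∧ |b n| ≤ W * 760 ^ n * n ^ 2 ∧
      |c n| ≤ W * 760 ^ n * n ^ 4 := by
  refine ⟨|a 1| + |b 1| + |c 1|, by positivity, fun n hn => ?_⟩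
  set W := |a 1| + |b 1| + |c 1| with hW
  have ha := abs_nonneg (a 1)
  have hb := abs_nonneg (b 1)
  have hc := abs_nonneg (c 1)
  induction n, hn using Nat.le_induction with
  | base =>
    norm_num
    refine ⟨?_, ?_, ?_⟩ <;> linarith
  | succ n hn ih =>
    obtain ⟨iha, ihb, ihc⟩ := ih
    rw [h.fst n hn, h.snd n hn, h.thd n hn]
    have hn1 : (1 : ℝ) ≤ n := by exact_mod_cast hn
    set V := W * 760 ^ n with hV
    have hV0 : 0 ≤ V := by positivity
    have hV1 : W * 760 ^ (n + 1) = 760 * V := by rw [hV]; ring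
    rw [hV1]
    push_cast
    generalize (n : ℝ) = t at *
    have ht : 0 < t + 1 := by linarith
    have tri (x y z : ℝ) : |x + y - z| ≤ |x| + |y| + |z| :=
      (abs_sub _ _).trans (by gcongr; exact abs_add_le _ _)
    have step {r x R s : ℝ} (hr : 0 ≤ r) (hx : |x| ≤ V * s) (hR : r * s ≤ R) :
        |r * x| ≤ V * R := by
      rw [abs_mul, abs_of_nonneg hr]
      calc r * |x| ≤ r * (V * s) := by gcongr
        _ = V * (r * s) := by ring
        _ ≤ V * R := by gcongr
    have iha' : |a n| ≤ V * 1 := by simpa using iha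
    refine ⟨?_, ?_, ?_⟩
    · have e1 := step (r := (302 * t ^ 4 + 360 * t ^ 3 + 215 * t ^ 2 + 68 * t + 9) / (t + 1) ^ 4)
        (R := 302) (by positivity) iha' (by
          rw [mul_one, div_le_iff₀ (by positivity), ← sub_nonneg]; ring_nf; positivity)
      have e2 := step (r := (262 * t ^ 3 + 557 * t ^ 2 + 230 * t + 33) / (t + 1) ^ 5)
        (R := 262) (by positivity) ihb (by
          rw [div_mul_eq_mul_div, div_le_iff₀ (by positivity), ← sub_nonneg]
          ring_nf; positivity)
      have e3 := step (r := 196 * t / (t + 1) ^ 5)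
        (R := 196) (by positivity) ihc (by
          rw [div_mul_eq_mul_div, div_le_iff₀ (by positivity), ← sub_nonneg]
          ring_nf; positivity)
      exact (tri _ _ _).trans (by linarith)
    · have e1 := step (r := (98 * t ^ 4 + 110 * t ^ 3 + 60 * t ^ 2 + 17 * t + 2) / (t + 1) ^ 2)
        (R := 98 * (t + 1) ^ 2) (by positivity) iha' (by
          rw [mul_one, div_le_iff₀ (by positivity), ← sub_nonneg]; ring_nf; positivity)
      have e2 := step (r := (90 * t ^ 3 + 192 * t ^ 2 + 81 * t + 12) / (t + 1) ^ 3)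
        (R := 90 * (t + 1) ^ 2) (by positivity) ihb (by
          rw [div_mul_eq_mul_div, div_le_iff₀ (by positivity), ← sub_nonneg]
          ring_nf; positivity)
      have e3 := step (r := 66 * t / (t + 1) ^ 3)
        (R := 66 * (t + 1) ^ 2) (by positivity) ihc (by
          rw [div_mul_eq_mul_div, div_le_iff₀ (by positivity), ← sub_nonneg]
          ring_nf; positivity)
      refine (abs_add_le _ _).trans ((add_le_add_left (abs_sub _ _) _).trans ?_)
      rw [abs_neg]
      have : 0 ≤ V * (t + 1) ^ 2 := by positivity
      linarith
    · have e1 := step (r := t * (33 * t ^ 3 + 32 * t ^ 2 + 13 * t + 2))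
        (R := 33 * (t + 1) ^ 4) (by positivity) iha' (by
          rw [← sub_nonneg]; ring_nf; positivity)
      have e2 := step (r := (34 * t ^ 3 + 73 * t ^ 2 + 32 * t + 5) / (t + 1))
        (R := 34 * (t + 1) ^ 4) (by positivity) ihb (by
          rw [div_mul_eq_mul_div, div_le_iff₀ (by positivity), ← sub_nonneg]
          ring_nf; positivity)
      have e3 := step (r := 24 * t / (t + 1))
        (R := 24 * (t + 1) ^ 4) (by positivity) ihc (by
          rw [div_mul_eq_mul_div, div_le_iff₀ (by positivity), ← sub_nonneg]
          ring_nf; positivity)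
      have : 0 ≤ V * (t + 1) ^ 4 := by positivity
      exact (tri _ _ _).trans (by linarith)

/-- The series are `O(n ^ 4 / 128 ^ n)`. -/
theorem exists_bound_wellPoisedSeries : ∃ S : ℝ, 0 ≤ S ∧ ∀ k ≤ 1, ∀ n : ℕ, 1 ≤ n →
    |wellPoisedSeries k n| ≤ S * (n ^ 4 / 128 ^ n) := by
  have hZ := (hasSum_zetaR (m := 3) (by norm_num))
  refine ⟨96 * zetaR (3 : ℕ), by linarith [one_le_zetaR (m := 3) (by norm_num)],
    fun k hk n hn => ?_⟩
  have hn0 : (0 : ℝ) < n := by exact_mod_cast hn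
  have hcb : 1 / (n.centralBinom : ℝ) ≤ 2 * n / 4 ^ n := by
    have h : (4 : ℝ) ^ n ≤ 2 * n * n.centralBinom := by
      exact_mod_cast Nat.four_pow_le_two_mul_self_mul_centralBinom n hn
    rw [div_le_div_iff₀ (by exact_mod_cast n.centralBinom_pos) (by positivity)]
    linarith
  set B : ℝ := 2 ^ n / (n.centralBinom : ℝ) ^ 4 with hB
  have hBle : 6 * B ≤ 96 * (n ^ 4 / 128 ^ n) := by
    have e : (128 : ℝ) ^ n * 2 ^ n = (4 ^ n) ^ 4 := by
      rw [← mul_pow, ← pow_mul, mul_comm n 4, pow_mul]; norm_num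
    calc 6 * B = 6 * (2 ^ n * (1 / (n.centralBinom : ℝ)) ^ 4) := by rw [hB]; ring
      _ ≤ 6 * (2 ^ n * (2 * n / 4 ^ n) ^ 4) := by gcongr
      _ = 96 * (n ^ 4 * 2 ^ n / (4 ^ n) ^ 4) := by rw [div_pow]; ring
      _ = _ := by rw [← e]; field_simp
  have hterm (i : ℕ) : ‖wellPoisedTerm k n ((i : ℝ) + 1)‖ ≤ 6 * B * (1 / ((i : ℝ) + 1) ^ 3) := by
    have h1 : (1 : ℝ) ≤ (i : ℝ) + 1 := by linarith [(i.cast_nonneg : (0 : ℝ) ≤ i)]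
    calc ‖wellPoisedTerm k n ((i : ℝ) + 1)‖
        ≤ 3 * 2 ^ k * ((i : ℝ) + 1) ^ (2 * k + 1) * |kernel n ((i : ℝ) + 1)| :=
          abs_wellPoisedTerm_le k n i
      _ ≤ 3 * 2 ^ 1 * ((i : ℝ) + 1) ^ 3 * (B / ((i : ℝ) + 1) ^ 6) := by
          gcongr ?_ * ?_ * ?_
          · gcongr; norm_num
          · exact pow_le_pow_right₀ h1 (by omega)
          · exact abs_kernel_le_centralBinom n i
      _ = _ := by field_simp; ring
  have h := tsum_of_norm_bounded (hZ.mul_left (6 * B)) hterm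
  rw [Real.norm_eq_abs] at h
  calc |wellPoisedSeries k n| ≤ 6 * B * zetaR (3 : ℕ) := h
    _ ≤ 96 * (n ^ 4 / 128 ^ n) * zetaR (3 : ℕ) := by
        gcongr; linarith [one_le_zetaR (m := 3) (by norm_num)]
    _ = _ := by ring

/-- Minors of a solution of the contiguity system against the well-poised series grow slowly,
because `760 / 128 < 7`. -/
theorem IsContiguous.exists_minor_bound {a b c : ℕ → ℝ} (h : IsContiguous a b c) :
    ∃ D : ℝ, ∀ n : ℕ, 1 ≤ n →
      |a n * wellPoisedSeries 1 n - b n * wellPoisedSeries 0 n| ≤ D * 7 ^ n := by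
  obtain ⟨W, hW0, hW⟩ := h.exists_bound
  obtain ⟨S, hS0, hS⟩ := exists_bound_wellPoisedSeries
  have hlim := tendsto_pow_const_mul_const_pow_of_lt_one 6
    (show (0 : ℝ) ≤ 760 / 128 / 7 by norm_num) (by norm_num)
  obtain ⟨E, hE⟩ := hlim.bddAbove_range
  refine ⟨2 * W * S * E, fun n hn => ?_⟩
  have hE' : (n : ℝ) ^ 6 * (760 / 128 / 7) ^ n ≤ E := hE ⟨n, rfl⟩
  obtain ⟨ha, hb, -⟩ := hW n hn
  have hs0 := hS 0 (by norm_num) n hn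
  have hs1 := hS 1 le_rfl n hn
  have hn1 : (1 : ℝ) ≤ n := by exact_mod_cast hn
  have ha' : |a n| ≤ W * 760 ^ n * n ^ 2 :=
    ha.trans (le_mul_of_one_le_right (by positivity) (one_le_pow₀ hn1))
  calc |a n * wellPoisedSeries 1 n - b n * wellPoisedSeries 0 n|
      ≤ |a n| * |wellPoisedSeries 1 n| + |b n| * |wellPoisedSeries 0 n| := by
        rw [← abs_mul, ← abs_mul]; exact abs_sub _ _
    _ ≤ W * 760 ^ n * n ^ 2 * (S * (n ^ 4 / 128 ^ n))
        + W * 760 ^ n * n ^ 2 * (S * (n ^ 4 / 128 ^ n)) := by gcongr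
    _ = 2 * W * S * (n ^ 6 * (760 / 128 / 7) ^ n) * 7 ^ n := by
        rw [div_pow, div_pow]; field_simp; ring
    _ ≤ 2 * W * S * E * 7 ^ n := by gcongr

/-! ### The linear forms as minors -/

/-- A solution agreeing with a multiple of the minors at `n = 1, 2, 3` grows slowly. The equation
with parameter `2` involves the term of index `0`, so three terms have to be compared from `n = 1`
on. -/
theorem IsSolution.abs_le_of_minor {x a b c : ℕ → ℝ} (hx : IsSolution x)
    (h : IsContiguous a b c) (κ : ℝ)
    (hx0 : ∀ n ∈ ({1, 2, 3} : Finset ℕ),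
      x n = κ * (a n * wellPoisedSeries 1 n - b n * wellPoisedSeries 0 n)) (n : ℕ) :
    |x (n + 2)| ≤ 10 * max |x (n + 1)| |x n| := by
  have hrec := h.minor_recurrence isContiguous_wellPoisedSeries (fun n _ => rfl)
  set y : ℕ → ℝ := fun n => a n * wellPoisedSeries 1 n - b n * wellPoisedSeries 0 n with hy
  have key (n : ℕ) : x (n + 1) = κ * y (n + 1) ∧ x (n + 2) = κ * y (n + 2) ∧
      x (n + 3) = κ * y (n + 3) := by
    induction n with
    | zero => exact ⟨hx0 1 (by simp), hx0 2 (by simp), hx0 3 (by simp)⟩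
    | succ n ih =>
      refine ⟨ih.2.1, ih.2.2, ?_⟩
      have e1 := hx.add_two (n + 1)
      have e2 := hrec (n + 1) (by omega)
      have h3 := (c₃_pos (K := ℝ) (n + 1)).ne'
      obtain ⟨i1, i2, i3⟩ := ih
      simp only [add_assoc, Nat.reduceAdd] at *
      rw [i1, i2, i3] at e1
      apply mul_left_cancel₀ h3
      linear_combination e1 - κ * e2
  obtain ⟨D, hD⟩ := h.exists_minor_bound
  refine hx.abs_le_of_growth (D := |κ| * D * 7) (fun n => ?_) n
  rw [(key n).1, abs_mul]
  calc |κ| * |y (n + 1)| ≤ |κ| * (D * 7 ^ (n + 1)) := by gcongr; exact hD _ (by omega)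
    _ = _ := by ring

/-- The triple `(66, -24, 10)` consists of the coefficients of `ζ(3)` in the three series for
`n = 1`: eliminating `ζ(3)` leaves a multiple of `ell`. -/
theorem ell_growth (n : ℕ) : |ell (n + 2)| ≤ 10 * max |ell (n + 1)| |ell n| := by
  obtain ⟨a, b, c, h, ha, hb, hc⟩ := exists_isContiguous 66 (-24) 10
  refine isSolution_ell.abs_le_of_minor h (1 / 4) ?_ n
  have h' := isContiguous_wellPoisedSeries
  have e2 := h.minor_fst_snd h' 1 le_rfl
  have f2 := h.minor_fst_thd h' 1 le_rfl
  have g2 := h.minor_snd_thd h' 1 le_rfl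
  have e3 := h.minor_fst_snd h' 2 (by norm_num)
  norm_num only [Nat.reduceAdd, Nat.cast_ofNat, Nat.cast_one] at e2 f2 g2 e3
  rw [e2, f2, g2] at e3
  rw [ha, hb, hc, wellPoisedSeries_zero_one, wellPoisedSeries_one_one,
    wellPoisedSeries_two_one] at e2 e3
  intro n hn
  simp only [Finset.mem_insert, Finset.mem_singleton] at hn
  rcases hn with rfl | rfl | rfl
  · rw [ha, hb, wellPoisedSeries_zero_one, wellPoisedSeries_one_one, ell, q_one, p_one]
    push_cast; ring
  · rw [e2, ell, q_two, p_two]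
    push_cast; ring
  · rw [e3, ell, q_three, p_three]
    push_cast; ring

/-- The triple `(18, -4, 0)` consists of the coefficients of `ζ(5)` in the three series for
`n = 1`: eliminating `ζ(5)` leaves a multiple of `ellTilde`. -/
theorem ellTilde_growth (n : ℕ) :
    |ellTilde (n + 2)| ≤ 10 * max |ellTilde (n + 1)| |ellTilde n| := by
  obtain ⟨a, b, c, h, ha, hb, hc⟩ := exists_isContiguous 18 (-4) 0
  refine isSolution_ellTilde.abs_le_of_minor h (-1 / 4) ?_ n
  have h' := isContiguous_wellPoisedSeries
  have e2 := h.minor_fst_snd h' 1 le_rfl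
  have f2 := h.minor_fst_thd h' 1 le_rfl
  have g2 := h.minor_snd_thd h' 1 le_rfl
  have e3 := h.minor_fst_snd h' 2 (by norm_num)
  norm_num only [Nat.reduceAdd, Nat.cast_ofNat, Nat.cast_one] at e2 f2 g2 e3
  rw [e2, f2, g2] at e3
  rw [ha, hb, hc, wellPoisedSeries_zero_one, wellPoisedSeries_one_one,
    wellPoisedSeries_two_one] at e2 e3
  intro n hn
  simp only [Finset.mem_insert, Finset.mem_singleton] at hn
  rcases hn with rfl | rfl | rfl
  · rw [ha, hb, wellPoisedSeries_zero_one, wellPoisedSeries_one_one, ellTilde, q_one, pTilde_one]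
    push_cast; ring
  · rw [e2, ellTilde, q_two, pTilde_two]
    push_cast; ring
  · rw [e3, ellTilde, q_three, pTilde_three]
    push_cast; ring

/-! ### Signs of the linear forms -/

theorem zetaR_five_bounds : 1 ≤ zetaR 5 ∧ zetaR 5 ≤ 2 := by
  have h := one_le_zetaR (m := 5) (by norm_num)
  have h' := zetaR_le_two (m := 5) (by norm_num)
  push_cast at h h'
  exact ⟨h, h'⟩

theorem zetaR_three_bounds : 1 ≤ zetaR 3 ∧ zetaR 3 ≤ 2 := by
  have h := one_le_zetaR (m := 3) (by norm_num)
  have h' := zetaR_le_two (m := 3) (by norm_num)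
  push_cast at h h'
  exact ⟨h, h'⟩

theorem abs_ell_le (n : ℕ) : |ell n| ≤ 45 := by
  refine (isSolution_ell.abs_le_max_initial ell_growth n).trans (max_le ?_ ?_) <;>
  · obtain ⟨h1, h2⟩ := zetaR_five_bounds
    simp only [ell, q_one, p_one, q_zero, p_zero]
    push_cast
    rw [abs_le]
    constructor <;> linarith

theorem abs_ellTilde_le (n : ℕ) : |ellTilde n| ≤ 60 := by
  refine (isSolution_ellTilde.abs_le_max_initial ellTilde_growth n).trans (max_le ?_ ?_) <;>
  · obtain ⟨h1, h2⟩ := zetaR_three_bounds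
    simp only [ellTilde, q_one, pTilde_one, q_zero, pTilde_zero]
    push_cast
    rw [abs_le]
    constructor <;> linarith

theorem ell_pos (n : ℕ) : 0 < ell (n + 1) := by
  -- boundedness of `ell 4` determines `ζ(5)` up to `45 / |q 4| < 10 ^ (-8)`
  have h4 := abs_le.1 (abs_ell_le 4)
  simp only [ell, q_four, p_four] at h4
  push_cast at h4
  refine isSolution_ell.pos_of_growth ell_growth ?_ ?_ n
  · simp only [ell, q_one, p_one]; push_cast; linarith [h4.1, h4.2]
  · simp only [ell, q_two, p_two]; push_cast; linarith [h4.1, h4.2]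

theorem neg_ellTilde_growth (n : ℕ) :
    |-ellTilde (n + 2)| ≤ 10 * max |-ellTilde (n + 1)| |-ellTilde n| := by
  simpa only [abs_neg] using ellTilde_growth n

theorem neg_ellTilde_pos (n : ℕ) : 0 < -ellTilde (n + 1) := by
  -- boundedness of `ellTilde 4` determines `ζ(3)` up to `60 / |q 4| < 10 ^ (-8)`
  have h4 := abs_le.1 (abs_ellTilde_le 4)
  simp only [ellTilde, q_four, pTilde_four] at h4
  push_cast at h4
  refine isSolution_ellTilde.neg.pos_of_growth neg_ellTilde_growth ?_ ?_ n
  · simp only [ellTilde, q_one, pTilde_one]; push_cast; linarith [h4.1, h4.2]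
  · simp only [ellTilde, q_two, pTilde_two]; push_cast; linarith [h4.1, h4.2]

/-! ### Logarithmic asymptotics -/

theorem tendsto_log_div_recessive {x : ℕ → ℝ} (hx : IsSolution x)
    (h : ∀ n, |x (n + 2)| ≤ 10 * max |x (n + 1)| |x n|) (hpos : ∀ n, 0 < x (n + 1)) {μ : ℝ}
    (hμ : 1 / 4 ≤ μ) (hμ' : μ ≤ 1 / 2) (hroot : μ ^ 3 + 2368 * μ ^ 2 - 752 * μ - 16 = 0) :
    Tendsto (fun n : ℕ => Real.log |x n| / n) atTop (𝓝 (Real.log |μ|)) := by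
  refine tendsto_log_div_of_tendsto_ratio (by linarith)
    (hx.tendsto_ratio_of_growth h hpos hμ hμ' hroot) ?_
  filter_upwards [eventually_ge_atTop 1] with n hn
  obtain ⟨k, rfl⟩ := Nat.exists_eq_add_of_le' hn
  exact (hpos k).ne'

theorem tendsto_log_div_dominant {x : ℕ → ℚ} (hx : IsSolution x) (hx2 : x 2 ≠ 0)
    (h1 : 10 * |x 1| ≤ |x 2|) (h0 : 10 * |x 0| ≤ |x 2|) {μ : ℝ} (hμ : μ < -1000)
    (hroot : μ ^ 3 + 2368 * μ ^ 2 - 752 * μ - 16 = 0) :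
    Tendsto (fun n : ℕ => Real.log |(x n : ℝ)| / n) atTop (𝓝 (Real.log |μ|)) := by
  have hx2' : (x 2 : ℝ) ≠ 0 := by exact_mod_cast hx2
  have h1' : 10 * |(x 1 : ℝ)| ≤ |(x 2 : ℝ)| := by exact_mod_cast h1
  have h0' : 10 * |(x 0 : ℝ)| ≤ |(x 2 : ℝ)| := by exact_mod_cast h0
  refine tendsto_log_div_of_tendsto_ratio (by linarith)
    (hx.cast.tendsto_ratio_dominant hx2' h1' h0' hμ hroot) ?_
  filter_upwards [eventually_ge_atTop 2] with n hn
  obtain ⟨k, rfl⟩ := Nat.exists_eq_add_of_le' hn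
  exact hx.cast.ne_zero_of_cone hx2' h1' h0' k

theorem ten_pow_le_abs_q (n : ℕ) : (10 : ℝ) ^ n ≤ |(q (n + 2) : ℝ)| := by
  have h := isSolution_q.cast.ten_pow_le (n := 0) (by norm_num) (by norm_num) n
  norm_num at h
  refine le_trans ?_ h
  have : (0 : ℝ) < 10 ^ n := by positivity
  linarith

theorem q_ne_zero (n : ℕ) : (q (n + 2) : ℝ) ≠ 0 :=
  abs_pos.1 (lt_of_lt_of_le (by positivity) (ten_pow_le_abs_q n))

theorem zetaR_sub_eq (n : ℕ) :
    zetaR 5 - ((p (n + 2) / q (n + 2) : ℚ) : ℝ) = ell (n + 2) / q (n + 2) := by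
  have := q_ne_zero n
  rw [ell]
  push_cast
  field_simp

theorem tendsto_p_div_q :
    Tendsto (fun n : ℕ => ((p n / q n : ℚ) : ℝ)) atTop (𝓝 (zetaR 5)) := by
  rw [← tendsto_add_atTop_iff_nat 2]
  have h0 : Tendsto (fun n : ℕ => 45 * (1 / 10 : ℝ) ^ n) atTop (𝓝 0) := by
    have := (tendsto_pow_atTop_nhds_zero_of_lt_one (show (0 : ℝ) ≤ 1 / 10 by norm_num)
      (by norm_num)).const_mul 45
    simpa using this
  refine tendsto_iff_norm_sub_tendsto_zero.2 (squeeze_zero (fun n => norm_nonneg _)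
    (fun n => ?_) h0)
  rw [norm_sub_rev, zetaR_sub_eq, Real.norm_eq_abs, abs_div]
  calc |ell (n + 2)| / |(q (n + 2) : ℝ)| ≤ 45 / 10 ^ n := by
        gcongr
        · exact abs_ell_le _
        · exact ten_pow_le_abs_q n
    _ = _ := by rw [div_pow]; ring

theorem tendsto_log_zetaR_sub {μ₂ μ₃ : ℝ} (h₂ : μ₂ ≠ 0) (h₃ : μ₃ ≠ 0)
    (hl : Tendsto (fun n : ℕ => Real.log |ell n| / n) atTop (𝓝 (Real.log |μ₂|)))
    (hq : Tendsto (fun n : ℕ => Real.log |(q n : ℝ)| / n) atTop (𝓝 (Real.log |μ₃|))) :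
    Tendsto (fun n : ℕ => Real.log |zetaR 5 - ((p n / q n : ℚ) : ℝ)| / n) atTop
      (𝓝 (Real.log |μ₂ / μ₃|)) := by
  rw [abs_div, Real.log_div (abs_ne_zero.2 h₂) (abs_ne_zero.2 h₃)]
  refine (hl.sub hq).congr' ?_
  filter_upwards [eventually_ge_atTop 2] with n hn
  obtain ⟨k, rfl⟩ := Nat.exists_eq_add_of_le' hn
  rw [zetaR_sub_eq, abs_div, Real.log_div (abs_ne_zero.2 (ell_pos (k + 1)).ne')
    (abs_ne_zero.2 (q_ne_zero k)), sub_div]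

end ZetaFive

open ZetaFive in
theorem theorem1 :
    -- the three sequences are linearly independent solutions, the linear forms are solutions
    ZetaFive.IsSolution ZetaFive.q ∧ ZetaFive.IsSolution ZetaFive.p ∧
    ZetaFive.IsSolution ZetaFive.pTilde ∧
    LinearIndependent ℚ ![ZetaFive.q, ZetaFive.p, ZetaFive.pTilde] ∧
    ZetaFive.IsSolution ZetaFive.ell ∧ ZetaFive.IsSolution ZetaFive.ellTilde ∧
    -- constant sign
    (∀ n : ℕ, 1 ≤ n → 0 < ZetaFive.ell n) ∧
    (∀ n : ℕ, 1 ≤ n → ZetaFive.ellTilde n < 0) ∧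
    -- the characteristic polynomial
    ZetaFive.IsCharacteristicPolynomial
      (X ^ 3 + C 2368 * X ^ 2 - C 752 * X - C 16 : ℝ[X]) ∧
    ∃ μ₁ μ₂ μ₃ : ℝ,
      -- its roots
      (X ^ 3 + C 2368 * X ^ 2 - C 752 * X - C 16 : ℝ[X]).roots = {μ₁, μ₂, μ₃} ∧
      (-0.02001513 < μ₁ ∧ μ₁ < -0.02001512) ∧
      (0.33753726 < μ₂ ∧ μ₂ < 0.33753727) ∧
      (-2368.31752214 < μ₃ ∧ μ₃ < -2368.31752213) ∧
      -- the limit relations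
      Tendsto (fun n : ℕ => Real.log |ZetaFive.ell n| / n) atTop (𝓝 (Real.log |μ₂|)) ∧
      Tendsto (fun n : ℕ => Real.log |ZetaFive.ellTilde n| / n) atTop (𝓝 (Real.log |μ₂|)) ∧
      (-1.08607937 < Real.log |μ₂| ∧ Real.log |μ₂| < -1.08607936) ∧
      Tendsto (fun n : ℕ => Real.log |(ZetaFive.q n : ℝ)| / n) atTop (𝓝 (Real.log |μ₃|)) ∧
      Tendsto (fun n : ℕ => Real.log |(ZetaFive.p n : ℝ)| / n) atTop (𝓝 (Real.log |μ₃|)) ∧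
      Tendsto (fun n : ℕ => Real.log |(ZetaFive.pTilde n : ℝ)| / n) atTop
        (𝓝 (Real.log |μ₃|)) ∧
      -- convergence of `p_n / q_n` to `ζ(5)` at geometric rate
      Tendsto (fun n : ℕ => ((ZetaFive.p n / ZetaFive.q n : ℚ) : ℝ)) atTop
        (𝓝 (ZetaFive.zetaR 5)) ∧
      Tendsto (fun n : ℕ =>
          Real.log |ZetaFive.zetaR 5 - ((ZetaFive.p n / ZetaFive.q n : ℚ) : ℝ)| / n) atTop
        (𝓝 (Real.log |μ₂ / μ₃|)) ∧
      |μ₂ / μ₃| < 1.42521964e-4 := by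
  -- narrower brackets than stated, as the bounds for `log μ₂` and `μ₂ / μ₃` require
  obtain ⟨μ₁, l₁, u₁, r₁⟩ := exists_root_of_sign (l := -0.02001513) (u := -0.02001512)
    (by norm_num) (by norm_num)
  obtain ⟨μ₂, l₂, u₂, r₂⟩ := exists_root_of_sign (l := 0.3375372644) (u := 0.3375372645)
    (by norm_num) (by norm_num)
  obtain ⟨μ₃, l₃, u₃, r₃⟩ := exists_root_of_sign (l := -2368.31752214) (u := -2368.31752213)
    (by norm_num) (by norm_num)
  have a₂ : |μ₂| = μ₂ := abs_of_pos (by linarith)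
  have hell := tendsto_log_div_recessive isSolution_ell ell_growth ell_pos (μ := μ₂)
    (by linarith) (by linarith) r₂
  have hellT := tendsto_log_div_recessive isSolution_ellTilde.neg neg_ellTilde_growth
    neg_ellTilde_pos (μ := μ₂) (by linarith) (by linarith) r₂
  simp only [abs_neg] at hellT
  have hq := tendsto_log_div_dominant isSolution_q (by norm_num) (by norm_num) (by norm_num)
    (μ := μ₃) (by linarith) r₃
  refine ⟨isSolution_q, isSolution_p, isSolution_pTilde, linearIndependent_q_p_pTilde,
    isSolution_ell, isSolution_ellTilde, fun n hn => ?_, fun n hn => ?_,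
    isCharacteristicPolynomial, μ₁, μ₂, μ₃,
    roots_eq_of_distinct (by linarith) (by linarith) (by linarith) r₁ r₂ r₃, ⟨l₁, u₁⟩,
    ⟨by linarith, by linarith⟩, ⟨l₃, u₃⟩, hell, hellT, ?_, hq,
    tendsto_log_div_dominant isSolution_p (by norm_num) (by norm_num) (by norm_num)
      (by linarith) r₃,
    tendsto_log_div_dominant isSolution_pTilde (by norm_num) (by norm_num) (by norm_num)
      (by linarith) r₃,
    tendsto_p_div_q, tendsto_log_zetaR_sub (by linarith) (by linarith) hell hq, ?_⟩
  · obtain ⟨k, rfl⟩ := Nat.exists_eq_add_of_le' hn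
    exact ell_pos k
  · obtain ⟨k, rfl⟩ := Nat.exists_eq_add_of_le' hn
    exact neg_pos.1 (neg_ellTilde_pos k)
  · rw [a₂]; exact log_bounds l₂ u₂
  · rw [abs_div, a₂, abs_of_neg (by linarith : μ₃ < 0), div_lt_iff₀ (by linarith)]
    linarith
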